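/- **Theorem (expected error decay for the Gaussian sketch).** Let $q\ge 1$ and $m,n,d$ be integers with $m>d+3$, let $A\in\mathbb R^{n\times d}$ have full column rank, let $b\in\mathbb R^n$, and let $x^*$ be the minimizer of $x\mapsto\|Ax-b\|_2^2$. Set $$\theta_1=\frac{m}{m-d-1},\qquad \theta_2=\frac{m^2(m-1)}{(m-d)(m-d-1)(m-d-3)} .$$ Let $S_{t,k}\in\mathbb R^{m\times n}$ ($t\ge 0$, $1\le k\le q$) be i.i.d. Gaussian sketches, that is, all entries of all these matrices are independent $\mathcal N(0,1/m)$ random variables (variance $1/m$). Consider distributed iterative Hessian sketch with step size $\mu=1/\theta_1$, started at a deterministic $x_0\in\mathbb R^d$: for $t=0,1,2,\dots$, $$x_{t+1}=x_t+\frac{\mu}{q}\sum_{k=1}^q\hat\Delta_{t,k},\qquad \hat\Delta_{t,k}=\arg\min_{\Delta\in\mathbb R^d}\ \tfrac12\|S_{t,k}A\Delta\|_2^2+g_t^T\Delta,\qquad g_t=A^T(Ax_t-b),$$ where $\hat\Delta_{t,k}:=0$ if no minimizer exists. Let $e_t=A(x_t-x^*)$. Then for every $t\ge 0$ the variable $\|e_t\|_2^2$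 is integrable and, almost surely, $$\mathbb E\big[\|e_{t+1}\|_2^2\,\big|\,S_{s,k},\ s<t,\ 1\le k\le q\big]=\frac1q\left(\frac{\theta_2}{\theta_1^2}-1\right)\|e_t\|_2^2 ;$$ consequently $\mathbb E\|e_{t+1}\|_2^2=\frac1q\left(\frac{\theta_2}{\theta_1^2}-1\right)\mathbb E\|e_t\|_2^2$. -/

import Mathlib

open Matrix MeasureTheory ProbabilityTheory
open scoped NNReal

namespace DistIHS

/-- The squared Euclidean norm of a real vector. -/
noncomputable def sqNorm {ι : Type*} [Fintype ι] (v : ι → ℝ) : ℝ :=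
  ‖WithLp.toLp 2 v‖ ^ 2

open Classical in
/-- A global minimizer of `f` (and `0` if `f` has no global minimizer). -/
noncomputable def argmin {ι : Type*} (f : (ι → ℝ) → ℝ) : ι → ℝ :=
  if h : ∃ x, IsMinOn f Set.univ x then h.choose else 0

/-- The constant `θ₁ = m / (m - d - 1)`. -/
noncomputable def theta1 (m d : ℕ) : ℝ :=
  (m : ℝ) / ((m : ℝ) - d - 1)

/-- The constant `θ₂ = m² (m - 1) / ((m - d) (m - d - 1) (m - d - 3))`. -/
noncomputable def theta2 (m d : ℕ) : ℝ :=
  (m : ℝ) ^ 2 * ((m : ℝ) - 1) /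
    (((m : ℝ) - d) * ((m : ℝ) - d - 1) * ((m : ℝ) - d - 3))

variable {q m n d : ℕ}

/-- The direction computed by one worker with sketch `S` from the gradient `g`: the minimizer of
`Δ ↦ (1 / 2) ‖S A Δ‖² + gᵀ Δ`. -/
noncomputable def workerDirection (A : Matrix (Fin n) (Fin d) ℝ) (S : Matrix (Fin m) (Fin n) ℝ)
    (g : Fin d → ℝ) : Fin d → ℝ :=
  argmin fun Δ => (1 / 2 : ℝ) * sqNorm ((S * A) *ᵥ Δ) + g ⬝ᵥ Δ

/-- The iterates of distributed iterative Hessian sketch with data `A`, `b`, step size `μ`,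
starting point `x₀` and sketching matrices `S t k` (iteration `t`, worker `k`):
`x (t + 1) = x t + μ (1 / q) ∑ k, Δ t k`, where `Δ t k` is the direction of worker `k` for the
gradient `Aᵀ (A x t - b)`. -/
noncomputable def iterate (A : Matrix (Fin n) (Fin d) ℝ) (b : Fin n → ℝ) (μ : ℝ)
    (x₀ : Fin d → ℝ) (S : ℕ → Fin q → Matrix (Fin m) (Fin n) ℝ) : ℕ → Fin d → ℝ
  | 0 => x₀
  | t + 1 =>
    iterate A b μ x₀ S t + (μ * (1 / (q : ℝ))) •
      ∑ k, workerDirection A (S t k) (Aᵀ *ᵥ (A *ᵥ iterate A b μ x₀ S t - b))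

/-- The error vector `A (x - x*)` of an approximate solution `x`. -/
def errorVec (A : Matrix (Fin n) (Fin d) ℝ) (xstar x : Fin d → ℝ) : Fin n → ℝ :=
  A *ᵥ (x - xstar)

/-- `S t k` are independent, identically distributed `m × n` Gaussian sketching matrices: all
entries of all the matrices are independent centered Gaussian variables of variance `1 / m`
(so that the expectation of `Sᵀ S` is the identity). -/
structure IsIIDGaussianSketch {Ω : Type*} [MeasurableSpace Ω] (P : Measure Ω)
    (S : ℕ → Fin q → Ω → Matrix (Fin m) (Fin n) ℝ) : Prop where
  measurable_entry : ∀ t k i j, Measurable fun ω => S t k ω i j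
  law_entry : ∀ t k i j,
    HasLaw (fun ω => S t k ω i j) (gaussianReal 0 ((m : ℝ≥0)⁻¹)) P
  indep : iIndepFun
    (fun (a : ℕ × Fin q × Fin m × Fin n) (ω : Ω) => S a.1 a.2.1 ω a.2.2.1 a.2.2.2) P

/-- The σ-algebra generated by the sketching matrices of the iterations before `t`, that is, by
all the randomness that enters the iterate `x t`. -/
def history {Ω : Type*} (S : ℕ → Fin q → Ω → Matrix (Fin m) (Fin n) ℝ) (t : ℕ) :
    MeasurableSpace Ω :=
  ⨆ (s : ℕ) (_ : s < t) (k : Fin q) (i : Fin m) (j : Fin n),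
    MeasurableSpace.comap (fun ω => S s k ω i j) inferInstance

end DistIHS

/-!
Write `A = U T` with orthonormal columns in `U` and `T` invertible. In the coordinates
`v = T (x - x*)` of the error, the step of a worker with sketch `S` is `-W v`, where
`W = (Gᵀ G)⁻¹` and `G = S U` (`mulVec_workerDirection`, with the normal equations for `x*`).
So almost surely `v (t + 1) = B v t` with `B = 1 - (μ / q) ∑ k, W k`, and
`‖e (t + 1)‖² = (v t)ᵀ B² (v t)`. As `v t` is a function of the earlier sketches and `B` is
independent of them, the conditional expectation is `(v t)ᵀ E[B²] (v t)`
(`condExp_quadraticForm`), and `E[B²]` is found from `E W = θ₁` and `E W² = θ₂`, the matrices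
`W k` being independent of each other (`integral_sq_one_sub_sum`). The iterates themselves need not
be measurable, since `argmin` chooses arbitrarily where a sketched Gram matrix is singular; they
agree almost surely with the measurable recursion `errCoord`.

The moments of `W`, an inverse Wishart matrix, come from Gaussian integration by parts
(`integral_sum_entry_mul_sub_eq_zero`). To stay within smooth bounded functions it is applied to
`M = (Gᵀ G + ε)⁻¹`, `ε > 0`, through the columns of `G M`, `G M²` and `tr(M) G M`. At `ε = 0` the
resulting identities would read, for entries of variance `v` and `x = m - d`,
* `1 = v (x - 1) E W`,
* `E W = v E[(x - 2) W² - tr(W) W]`,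
* `E tr(W) = v E[(x - 1) tr(W) W - 2 W²]`,
a linear system for `E W` and `E W²`. For `ε > 0` the extra terms have signs that give a bound on
`E (tr M)²` uniform in `ε`; here `x > 3` enters. By Fatou's lemma this bound gives at once the
almost sure invertibility of `Gᵀ G` and the integrability of `(tr W)²`
(`ae_isUnit_det_gram_and_integrable_trace_sq`), and dominated convergence gives the identities at
`ε = 0` (`integral_stein_zero_eq_zero`).
-/

namespace DistIHS

/-! ### Stein's identity for independent Gaussian variables -/

lemma hasDerivAt_gaussianPDFReal {v : ℝ≥0} (hv : v ≠ 0) (x : ℝ) :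
    HasDerivAt (gaussianPDFReal 0 v) (-(x / v) * gaussianPDFReal 0 v x) x := by
  have hv' : (v : ℝ) ≠ 0 := by exact_mod_cast hv
  have h : HasDerivAt (fun x : ℝ => -(x - 0) ^ 2 / (2 * v)) (-(x / v)) x := by
    have := (((hasDerivAt_id x).sub_const 0).pow 2).neg.div_const (2 * (v : ℝ))
    refine this.congr_deriv ?_
    simp
    field_simp
  have := h.exp.const_mul (√(2 * Real.pi * v))⁻¹
  rw [gaussianPDFReal_def]
  refine this.congr_deriv ?_
  simp only [sub_zero]
  ring

/-- Stein's identity (Gaussian integration by parts) on the line. -/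
lemma integral_id_mul_gaussianReal {v : ℝ≥0} (hv : v ≠ 0) {f f' : ℝ → ℝ}
    (hf : ∀ x, HasDerivAt f (f' x) x) (hf'm : Measurable f') {C C' : ℝ} (hC : ∀ x, |f x| ≤ C)
    (hC' : ∀ x, |f' x| ≤ C') :
    ∫ x, x * f x ∂gaussianReal 0 v = v * ∫ x, f' x ∂gaussianReal 0 v := by
  have hv' : (v : ℝ) ≠ 0 := by exact_mod_cast hv
  have hfm : Measurable f :=
    (continuous_iff_continuousAt.2 fun x => (hf x).continuousAt).measurable
  have hφ := integrable_gaussianPDFReal 0 v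
  have hxφ : Integrable (fun x => x * gaussianPDFReal 0 v x) := by
    have h := (memLp_id_gaussianReal (μ := 0) (v := v) 1).integrable le_rfl
    rw [gaussianReal_of_var_ne_zero _ hv, integrable_withDensity_iff
      (measurable_gaussianPDF 0 v) (by simp [gaussianPDF_lt_top])] at h
    simpa [toReal_gaussianPDF] using h
  have key := integral_mul_deriv_eq_deriv_mul_of_integrable (u := f) (u' := f')
    (v := gaussianPDFReal 0 v) (v' := fun x => -(x / v) * gaussianPDFReal 0 v x)
    (fun x _ => hf x) (fun x _ => hasDerivAt_gaussianPDFReal hv x) ?_ ?_ ?_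
  · rw [integral_gaussianReal_eq_integral_smul hv, integral_gaussianReal_eq_integral_smul hv]
    simp only [smul_eq_mul]
    have h1 : ∀ x, f x * (-(x / v) * gaussianPDFReal 0 v x)
        = -(v : ℝ)⁻¹ * (gaussianPDFReal 0 v x * (x * f x)) := fun x => by
      field_simp
    simp_rw [h1] at key
    rw [integral_const_mul] at key
    have h2 : ∀ x, f' x * gaussianPDFReal 0 v x = gaussianPDFReal 0 v x * f' x :=
      fun x => mul_comm _ _
    simp_rw [h2] at key
    have h3 := congrArg (fun z => (v : ℝ) * z) key
    simp only [neg_mul, mul_neg, neg_inj] at h3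
    rwa [mul_inv_cancel_left₀ hv'] at h3
  · have := (hxφ.const_mul (-(v : ℝ)⁻¹)).bdd_mul (c := C) hfm.aestronglyMeasurable
      (Filter.Eventually.of_forall hC)
    refine this.congr (Filter.Eventually.of_forall fun x => ?_)
    simp only [Pi.mul_apply]
    ring
  · exact hφ.bdd_mul (c := C') hf'm.aestronglyMeasurable (Filter.Eventually.of_forall hC')
  · exact hφ.bdd_mul (c := C) hfm.aestronglyMeasurable (Filter.Eventually.of_forall hC)

/-- Stein's identity in one coordinate of a finite family of independent centred Gaussian
variables of equal variance. -/
lemma integral_mul_eq_of_iIndepFun_gaussian {Ω κ : Type*} [MeasurableSpace Ω] {P : Measure Ω}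
    [IsProbabilityMeasure P] [Fintype κ] [DecidableEq κ] {v : ℝ≥0} (hv : v ≠ 0)
    {X : κ → Ω → ℝ} (hXm : ∀ c, Measurable (X c)) (hX : ∀ c, HasLaw (X c) (gaussianReal 0 v) P)
    (hind : iIndepFun X P) (c : κ) {f f' : (κ → ℝ) → ℝ} (hfm : Measurable f)
    (hf'm : Measurable f')
    (hf : ∀ x, HasDerivAt (fun s : ℝ => f (x + s • Pi.single c 1)) (f' x) 0)
    {C C' : ℝ} (hC : ∀ x, |f x| ≤ C) (hC' : ∀ x, |f' x| ≤ C') :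
    ∫ ω, X c ω * f (fun i => X i ω) ∂P = v * ∫ ω, f' (fun i => X i ω) ∂P := by
  let Y : Ω → κ → ℝ := fun ω => Function.update (fun i => X i ω) c 0
  have hYm : Measurable Y := by
    refine measurable_pi_lambda _ fun i => ?_
    by_cases h : i = c
    · subst h; simp [Y]
    · simpa [Y, h] using hXm i
  have hXY : IndepFun (X c) Y P := by
    have h := hind.indepFun_finset {c} {c}ᶜ (by simp) hXm
    refine h.comp (φ := fun z : ({c} : Finset κ) → ℝ => z ⟨c, by simp⟩)
      (ψ := fun (z : (({c}ᶜ : Finset κ)) → ℝ) i =>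
        if hi : i = c then 0 else z ⟨i, by simp [hi]⟩) (by fun_prop) ?_ |>.congr
      ?_ ?_
    · refine measurable_pi_lambda _ fun i => ?_
      by_cases h : i = c
      · simp [h]
      · simp only [h, dite_false]; fun_prop
    · rfl
    · refine Filter.Eventually.of_forall fun ω => ?_
      funext i
      by_cases h : i = c
      · subst h; simp [Y]
      · simp [Y, h]
  have hupd : ∀ ω, (fun i => X i ω) = Function.update (Y ω) c (X c ω) := fun ω => by
    simp [Y]
  have hlaw : P.map (fun ω => (X c ω, Y ω)) = (gaussianReal 0 v).prod (P.map Y) := by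
    rw [(indepFun_iff_map_prod_eq_prod_map_map (hXm c).aemeasurable hYm.aemeasurable).1 hXY,
      (hX c).map_eq]
  have : IsProbabilityMeasure (P.map Y) := Measure.isProbabilityMeasure_map hYm.aemeasurable
  have hum : Measurable fun p : ℝ × (κ → ℝ) => Function.update p.2 c p.1 := by
    refine measurable_pi_lambda _ fun i => ?_
    by_cases h : i = c
    · subst h; simpa using measurable_fst
    · simp only [Function.update_of_ne h]; fun_prop
  have hfu : Measurable fun p : ℝ × (κ → ℝ) => f (Function.update p.2 c p.1) := hfm.comp hum
  have hf'u : Measurable fun p : ℝ × (κ → ℝ) => f' (Function.update p.2 c p.1) := hf'm.comp hum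
  have e1 : ∫ ω, X c ω * f (fun i => X i ω) ∂P
      = ∫ p, p.1 * f (Function.update p.2 c p.1) ∂((gaussianReal 0 v).prod (P.map Y)) := by
    rw [← hlaw, integral_map (by fun_prop) (by fun_prop)]
    exact integral_congr_ae (Filter.Eventually.of_forall fun ω => by
      change _ = X c ω * f (Function.update (Y ω) c (X c ω))
      rw [← hupd])
  have e2 : ∫ ω, f' (fun i => X i ω) ∂P
      = ∫ p, f' (Function.update p.2 c p.1) ∂((gaussianReal 0 v).prod (P.map Y)) := by
    rw [← hlaw, integral_map (by fun_prop) hf'u.aestronglyMeasurable]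
    exact integral_congr_ae (Filter.Eventually.of_forall fun ω => by
      change _ = f' (Function.update (Y ω) c (X c ω))
      rw [← hupd])
  have i2 : Integrable (fun p : ℝ × (κ → ℝ) => f' (Function.update p.2 c p.1))
      ((gaussianReal 0 v).prod (P.map Y)) :=
    Integrable.of_bound hf'u.aestronglyMeasurable C' (Filter.Eventually.of_forall fun p => hC' _)
  have i1 : Integrable (fun p : ℝ × (κ → ℝ) => p.1 * f (Function.update p.2 c p.1))
      ((gaussianReal 0 v).prod (P.map Y)) := by
    have h := (memLp_id_gaussianReal (μ := 0) (v := v) 1).integrable le_rfl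
    exact (h.comp_fst (P.map Y)).mul_bdd (c := C) hfu.aestronglyMeasurable
      (Filter.Eventually.of_forall fun p => hC _)
  rw [e1, e2, integral_prod_symm _ i1, integral_prod_symm _ i2, ← integral_const_mul]
  refine integral_congr_ae (Filter.Eventually.of_forall fun y => ?_)
  refine integral_id_mul_gaussianReal hv (f := fun s => f (Function.update y c s))
    (f' := fun s => f' (Function.update y c s)) (fun s => ?_) (by fun_prop) (fun _ => hC _)
    (fun _ => hC' _)
  have h := hf (Function.update y c s)
  rw [← sub_self s] at h
  have h' := h.comp_sub_const s s
  refine h'.congr_of_eventuallyEq (Filter.Eventually.of_forall fun r => ?_)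
  simp only
  congr 1
  funext i
  by_cases hi : i = c
  · subst hi; simp
  · simp [hi]

/-! ### Stein's identity for Gaussian matrices -/

/-- `f' a i` is the partial derivative of `f` with respect to the entry `(a, i)` of its matrix
argument, and `f` and all `f' a i` are bounded and continuous. The derivative is required along
every direction supported on a single row, so that the chain rule for `S ↦ f (S * U)` is
immediate. -/
structure HasBoundedPartials {ρ ι : Type*} [Fintype ρ] [DecidableEq ρ] [Fintype ι]
    (f : Matrix ρ ι ℝ → ℝ) (f' : ρ → ι → Matrix ρ ι ℝ → ℝ) : Prop where
  continuous : Continuous f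
  continuous' : ∀ a i, Continuous (f' a i)
  bounded : ∃ C, ∀ G, |f G| ≤ C
  bounded' : ∀ a i, ∃ C, ∀ G, |f' a i G| ≤ C
  hasDerivAt : ∀ a (u : ι → ℝ) G,
    HasDerivAt (fun s : ℝ => f (G + s • vecMulVec (Pi.single a 1) u)) (∑ i, u i * f' a i G) 0

namespace HasBoundedPartials

variable {ρ ι : Type*} [Fintype ρ] [DecidableEq ρ] [Fintype ι]
  {f g : Matrix ρ ι ℝ → ℝ} {f' g' : ρ → ι → Matrix ρ ι ℝ → ℝ}

lemma mul (hf : HasBoundedPartials f f') (hg : HasBoundedPartials g g') :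
    HasBoundedPartials (fun G => f G * g G) (fun a i G => f' a i G * g G + f G * g' a i G) := by
  obtain ⟨C, hC⟩ := hf.bounded
  obtain ⟨D, hD⟩ := hg.bounded
  refine ⟨hf.continuous.mul hg.continuous,
    fun a i => ((hf.continuous' a i).mul hg.continuous).add
      (hf.continuous.mul (hg.continuous' a i)),
    ⟨C * D, fun G => ?_⟩, fun a i => ?_, fun a u G => ?_⟩
  · rw [abs_mul]
    exact mul_le_mul (hC G) (hD G) (abs_nonneg _) ((abs_nonneg _).trans (hC G))
  · obtain ⟨C', hC'⟩ := hf.bounded' a i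
    obtain ⟨D', hD'⟩ := hg.bounded' a i
    refine ⟨C' * D + C * D', fun G => (abs_add_le _ _).trans ?_⟩
    rw [abs_mul, abs_mul]
    exact add_le_add
      (mul_le_mul (hC' G) (hD G) (abs_nonneg _) ((abs_nonneg _).trans (hC' G)))
      (mul_le_mul (hC G) (hD' G) (abs_nonneg _) ((abs_nonneg _).trans (hC G)))
  · refine ((hf.hasDerivAt a u G).fun_mul (hg.hasDerivAt a u G)).congr_deriv ?_
    simp only [zero_smul, add_zero, mul_add, Finset.sum_add_distrib, Finset.sum_mul,
      Finset.mul_sum]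
    congr 1
    · exact Finset.sum_congr rfl fun i _ => by ring
    · exact Finset.sum_congr rfl fun i _ => by ring

lemma sum {κ : Type*} [Fintype κ] {f : κ → Matrix ρ ι ℝ → ℝ}
    {f' : κ → ρ → ι → Matrix ρ ι ℝ → ℝ} (hf : ∀ l, HasBoundedPartials (f l) (f' l)) :
    HasBoundedPartials (fun G => ∑ l, f l G) (fun a i G => ∑ l, f' l a i G) := by
  refine ⟨continuous_finsetSum _ fun l _ => (hf l).continuous,
    fun a i => continuous_finsetSum _ fun l _ => (hf l).continuous' a i, ?_, fun a i => ?_,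
    fun a u G => ?_⟩
  · choose C hC using fun l => (hf l).bounded
    exact ⟨∑ l, C l, fun G => (Finset.abs_sum_le_sum_abs _ _).trans
      (Finset.sum_le_sum fun l _ => hC l G)⟩
  · choose C hC using fun l => (hf l).bounded' a i
    exact ⟨∑ l, C l, fun G => (Finset.abs_sum_le_sum_abs _ _).trans
      (Finset.sum_le_sum fun l _ => hC l G)⟩
  · refine (HasDerivAt.fun_sum fun l _ => (hf l).hasDerivAt a u G).congr_deriv ?_
    rw [Finset.sum_comm]
    exact Finset.sum_congr rfl fun i _ => by rw [Finset.mul_sum]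

end HasBoundedPartials

lemma measurable_continuous_comp_matrix {Ω ρ ν : Type*} [MeasurableSpace Ω] [Fintype ρ]
    [Fintype ν] {S : Ω → Matrix ρ ν ℝ} (hS : ∀ a j, Measurable fun ω => S ω a j)
    {g : Matrix ρ ν ℝ → ℝ} (hg : Continuous g) : Measurable fun ω => g (S ω) := by
  have hg' : Continuous fun x : ρ → ν → ℝ => g (Matrix.of x) := hg
  exact hg'.measurable.comp (measurable_pi_lambda _ fun a => measurable_pi_lambda _ fun j => hS a j)

section Stein

variable {Ω ρ ν ι : Type*} [MeasurableSpace Ω] {P : Measure Ω} [IsProbabilityMeasure P]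
  [Fintype ρ] [DecidableEq ρ] [Fintype ν] [Fintype ι] [DecidableEq ι]
  {v : ℝ≥0} {S : Ω → Matrix ρ ν ℝ}

/-- Stein's identity for `G = S * U`, where `S` has independent Gaussian entries and `U` has
orthonormal columns. The entries of `G` are again independent Gaussians, but the identity follows
from the one for `S` by the chain rule, because `∑ j, U j i * U j p = δ i p`. -/
lemma integral_entry_mul_eq [DecidableEq ν] (hv : v ≠ 0) (hSm : ∀ a j, Measurable fun ω => S ω a j)
    (hS : ∀ a j, HasLaw (fun ω => S ω a j) (gaussianReal 0 v) P)
    (hind : iIndepFun (fun (c : ρ × ν) ω => S ω c.1 c.2) P)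
    {U : Matrix ν ι ℝ} (hU : Uᵀ * U = 1)
    {f : Matrix ρ ι ℝ → ℝ} {f' : ρ → ι → Matrix ρ ι ℝ → ℝ} (hf : HasBoundedPartials f f')
    (a : ρ) (i : ι) :
    Integrable (fun ω => (S ω * U) a i * f (S ω * U)) P ∧
    ∫ ω, (S ω * U) a i * f (S ω * U) ∂P = v * ∫ ω, f' a i (S ω * U) ∂P := by
  obtain ⟨C, hC⟩ := hf.bounded
  choose C' hC' using hf.bounded' a
  have hcont : Continuous fun T : Matrix ρ ν ℝ => T * U := by fun_prop
  have hfS : Measurable fun ω => f (S ω * U) :=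
    measurable_continuous_comp_matrix hSm (hf.continuous.comp hcont)
  have hf'S : ∀ p, Measurable fun ω => f' a p (S ω * U) :=
    fun p => measurable_continuous_comp_matrix hSm ((hf.continuous' a p).comp hcont)
  have hint : ∀ j, Integrable (fun ω => S ω a j * f (S ω * U)) P := fun j => by
    have h : Integrable (fun ω => S ω a j) P := by
      have := (memLp_id_gaussianReal (μ := 0) (v := v) 1).integrable le_rfl
      rw [← (hS a j).map_eq] at this
      exact (integrable_map_measure (by fun_prop) (hSm a j).aemeasurable).1 this
    exact h.mul_bdd (c := C) hfS.aestronglyMeasurable (Filter.Eventually.of_forall fun ω => hC _)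
  have hint' : ∀ p, Integrable (fun ω => f' a p (S ω * U)) P := fun p =>
    Integrable.of_bound (hf'S p).aestronglyMeasurable (C' p)
      (Filter.Eventually.of_forall fun ω => hC' p _)
  have hstein : ∀ j, ∫ ω, S ω a j * f (S ω * U) ∂P
      = v * ∑ p, U j p * ∫ ω, f' a p (S ω * U) ∂P := fun j => by
    have hmat : Continuous fun x : ρ × ν → ℝ => (Matrix.of fun a j => x (a, j)) * U := by fun_prop
    have h := integral_mul_eq_of_iIndepFun_gaussian (P := P) hv
      (X := fun (c : ρ × ν) ω => S ω c.1 c.2) (fun c => hSm _ _) (fun c => hS _ _) hind (a, j)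
      (f := fun x => f ((Matrix.of fun a j => x (a, j)) * U))
      (f' := fun x => ∑ p, U j p * f' a p ((Matrix.of fun a j => x (a, j)) * U))
      (C := C) (C' := ∑ p, |U j p| * C' p)
      (hf.continuous.comp hmat).measurable
      (Continuous.measurable (continuous_finsetSum _ fun p _ =>
        continuous_const.mul ((hf.continuous' a p).comp hmat)))
      (fun x => ?_) (fun x => hC _) (fun x => ?_)
    · have e : ∀ ω, (Matrix.of fun a j => S ω a j) = S ω := fun ω => rfl
      simp only [e] at h
      rw [h, integral_finsetSum _ fun p _ => (hint' p).const_mul _]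
      simp_rw [integral_const_mul]
    · refine (hf.hasDerivAt a (U j) _).congr_of_eventuallyEq
        (Filter.Eventually.of_forall fun s => ?_)
      simp only
      congr 1
      ext b p
      simp only [Matrix.mul_apply, Matrix.of_apply, Pi.add_apply, Pi.smul_apply, smul_eq_mul,
        Matrix.add_apply, Matrix.smul_apply, vecMulVec_apply, add_mul, Finset.sum_add_distrib]
      congr 1
      by_cases hb : b = a
      · subst hb
        rw [Finset.sum_eq_single j] <;> simp +contextual
      · simp [hb]
    · refine (Finset.abs_sum_le_sum_abs _ _).trans (Finset.sum_le_sum fun p _ => ?_)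
      rw [abs_mul]
      exact mul_le_mul_of_nonneg_left (hC' p _) (abs_nonneg _)
  have hexp : ∀ ω, (S ω * U) a i * f (S ω * U) = ∑ j, U j i * (S ω a j * f (S ω * U)) := fun ω => by
    rw [Matrix.mul_apply, Finset.sum_mul]
    exact Finset.sum_congr rfl fun j _ => by ring
  simp_rw [hexp]
  refine ⟨integrable_finsetSum _ fun j _ => (hint j).const_mul _, ?_⟩
  rw [integral_finsetSum _ fun j _ => (hint j).const_mul _]
  simp_rw [integral_const_mul, hstein]
  calc ∑ j, U j i * (v * ∑ p, U j p * ∫ ω, f' a p (S ω * U) ∂P)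
      = v * ∑ p, (Uᵀ * U) i p * ∫ ω, f' a p (S ω * U) ∂P := by
        simp only [Matrix.mul_apply, Matrix.transpose_apply, Finset.mul_sum, Finset.sum_mul]
        rw [Finset.sum_comm]
        exact Finset.sum_congr rfl fun p _ => Finset.sum_congr rfl fun j _ => by ring
    _ = v * ∫ ω, f' a i (S ω * U) ∂P := by
        rw [hU]
        simp [Matrix.one_apply]

/-- Stein's identity summed over the entries of a column of `G = S * U`. -/
lemma integral_sum_entry_mul_sub_eq_zero [DecidableEq ν] (hv : v ≠ 0)
    (hSm : ∀ a j, Measurable fun ω => S ω a j)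
    (hS : ∀ a j, HasLaw (fun ω => S ω a j) (gaussianReal 0 v) P)
    (hind : iIndepFun (fun (c : ρ × ν) ω => S ω c.1 c.2) P)
    {U : Matrix ν ι ℝ} (hU : Uᵀ * U = 1)
    {f : ρ → Matrix ρ ι ℝ → ℝ} {f' : ρ → ρ → ι → Matrix ρ ι ℝ → ℝ}
    (hf : ∀ a, HasBoundedPartials (f a) (f' a)) (i : ι) :
    Integrable (fun ω => ∑ a, (S ω * U) a i * f a (S ω * U) - v * ∑ a, f' a a i (S ω * U)) P ∧
    ∫ ω, (∑ a, (S ω * U) a i * f a (S ω * U) - v * ∑ a, f' a a i (S ω * U)) ∂P = 0 := by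
  have hcont : Continuous fun T : Matrix ρ ν ℝ => T * U := by fun_prop
  have h := fun a => integral_entry_mul_eq hv hSm hS hind hU (hf a) a i
  have h' : ∀ a, Integrable (fun ω => f' a a i (S ω * U)) P := fun a => by
    obtain ⟨C, hC⟩ := (hf a).bounded' a i
    exact Integrable.of_bound (measurable_continuous_comp_matrix hSm
      (((hf a).continuous' a i).comp hcont)).aestronglyMeasurable C
      (Filter.Eventually.of_forall fun ω => hC _)
  have i1 := integrable_finsetSum Finset.univ fun a _ => (h a).1
  have i2 := (integrable_finsetSum Finset.univ fun a _ => h' a).const_mul (v : ℝ)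
  refine ⟨i1.sub i2, ?_⟩
  rw [integral_sub i1 i2, integral_const_mul, integral_finsetSum _ fun a _ => (h a).1,
    integral_finsetSum _ fun a _ => h' a, Finset.mul_sum, sub_eq_zero]
  exact Finset.sum_congr rfl fun a _ => (h a).2

end Stein

/-! ### The regularized inverse Gram matrix and its derivatives -/

section RegInv

variable {ρ ι : Type*} [Fintype ρ] [Fintype ι] [DecidableEq ι]

/-- The regularized inverse Gram matrix `(Gᵀ G + ε)⁻¹`. For `ε > 0` it is a smooth bounded
function of `G`; for `ε = 0` it is the inverse Gram matrix itself (`0` if that does not exist). -/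
noncomputable def regInv (ε : ℝ) (G : Matrix ρ ι ℝ) : Matrix ι ι ℝ :=
  (Gᵀ * G + ε • (1 : Matrix ι ι ℝ))⁻¹

lemma regInv_transpose (ε : ℝ) (G : Matrix ρ ι ℝ) : (regInv ε G)ᵀ = regInv ε G := by
  simp [regInv, Matrix.transpose_nonsing_inv]

lemma regInv_symm (ε : ℝ) (G : Matrix ρ ι ℝ) (i j : ι) : regInv ε G i j = regInv ε G j i :=
  congrFun (congrFun (regInv_transpose ε G) j) i

lemma isUnit_det_gram_add {ε : ℝ} (hε : 0 < ε) (G : Matrix ρ ι ℝ) :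
    IsUnit (Gᵀ * G + ε • (1 : Matrix ι ι ℝ)).det := by
  have h : (Gᵀ * G + ε • (1 : Matrix ι ι ℝ)).PosDef :=
    PosDef.posSemidef_add (by simpa using posSemidef_conjTranspose_mul_self G)
      (PosDef.one.smul hε)
  exact h.det_pos.ne'.isUnit

lemma posSemidef_regInv {ε : ℝ} (hε : 0 ≤ ε) (G : Matrix ρ ι ℝ) : (regInv ε G).PosSemidef :=
  (PosSemidef.add (by simpa using posSemidef_conjTranspose_mul_self G)
      (PosSemidef.one.smul hε)).inv

variable {ε : ℝ} {G : Matrix ρ ι ℝ} (h : IsUnit (Gᵀ * G + ε • (1 : Matrix ι ι ℝ)).det)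
include h

lemma regInv_mul_gram : regInv ε G * (Gᵀ * G) = 1 - ε • regInv ε G := by
  have := Matrix.nonsing_inv_mul _ h
  rw [Matrix.mul_add, Matrix.mul_smul, Matrix.mul_one] at this
  exact eq_sub_of_add_eq this

lemma gram_mul_regInv : Gᵀ * G * regInv ε G = 1 - ε • regInv ε G := by
  have := Matrix.mul_nonsing_inv _ h
  rw [Matrix.add_mul, Matrix.smul_mul, Matrix.one_mul] at this
  exact eq_sub_of_add_eq this

lemma gram_mul_regInv_self :
    (G * regInv ε G)ᵀ * (G * regInv ε G) = regInv ε G - ε • (regInv ε G * regInv ε G) := by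
  rw [Matrix.transpose_mul, regInv_transpose, Matrix.mul_assoc, ← Matrix.mul_assoc Gᵀ,
    gram_mul_regInv h, Matrix.mul_sub, Matrix.mul_one, Matrix.mul_smul]

lemma trace_mul_regInv_mul :
    (G * regInv ε G * Gᵀ).trace = Fintype.card ι - ε * (regInv ε G).trace := by
  rw [Matrix.trace_mul_comm, ← Matrix.mul_assoc, gram_mul_regInv h]
  simp

omit h in
lemma continuous_regInv (hε : 0 < ε) : Continuous fun G : Matrix ρ ι ℝ => regInv ε G := by
  have hH : Continuous fun G : Matrix ρ ι ℝ => Gᵀ * G + ε • (1 : Matrix ι ι ℝ) := by fun_prop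
  simp only [regInv, Matrix.inv_def, Ring.inverse_eq_inv']
  exact (hH.matrix_det.inv₀ fun G => (isUnit_det_gram_add hε G).ne_zero).smul hH.matrix_adjugate

omit h in
/-- At an invertible Gram matrix the regularization can be removed. -/
lemma tendsto_regInv {G : Matrix ρ ι ℝ} (hG : IsUnit (Gᵀ * G).det) :
    Filter.Tendsto (fun ε => regInv ε G) (nhds 0) (nhds (regInv 0 G)) := by
  have hH : Continuous fun ε : ℝ => Gᵀ * G + ε • (1 : Matrix ι ι ℝ) := by fun_prop
  simp only [regInv, Matrix.inv_def, Ring.inverse_eq_inv']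
  refine Filter.Tendsto.smul (Filter.Tendsto.inv₀ hH.matrix_det.continuousAt ?_)
    hH.matrix_adjugate.continuousAt
  simpa using hG.ne_zero

end RegInv

section Bounds

variable {ι : Type*} [Fintype ι]

lemma abs_apply_le_trace {M : Matrix ι ι ℝ} (hM : M.PosSemidef) (i j : ι) :
    |M i j| ≤ M.trace := by
  classical
  have hd : ∀ i, 0 ≤ M i i := fun i => hM.diag_nonneg
  have hsym : M j i = M i j := by simpa using hM.isHermitian.apply i j
  by_cases hij : i = j
  · subst hij
    rw [abs_of_nonneg (hd i)]
    exact Finset.single_le_sum (f := fun i => M i i) (fun i _ => hd i) (Finset.mem_univ i)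
  have hsum : M i i + M j j ≤ M.trace := by
    rw [← Finset.sum_pair (f := fun i => M i i) hij]
    exact Finset.sum_le_univ_sum_of_nonneg hd
  -- testing against `e i ± e j` bounds `2 |M i j|` by `M i i + M j j`
  have h1 := hM.dotProduct_mulVec_nonneg (Pi.single i 1 + Pi.single j 1)
  have h2 := hM.dotProduct_mulVec_nonneg (Pi.single i 1 - Pi.single j 1)
  simp [Matrix.mulVec_add, Matrix.mulVec_sub, add_dotProduct, sub_dotProduct, hsym] at h1 h2
  rw [abs_le]
  constructor <;> linarith [hd i, hd j]

variable {ρ : Type*} [Fintype ρ] [DecidableEq ι] {ε : ℝ}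

/-- The diagonal of `M = (G M)ᵀ (G M) + ε M²` gives `ε M i j ^ 2 ≤ M i i`. -/
lemma abs_regInv_apply_le (hε : 0 < ε) (G : Matrix ρ ι ℝ) (i j : ι) :
    |regInv ε G i j| ≤ ε⁻¹ := by
  have h := gram_mul_regInv_self (isUnit_det_gram_add hε G)
  have key : ∀ i j, ε * regInv ε G i j ^ 2 ≤ regInv ε G i i := fun i j => by
    have h1 := congrFun (congrFun h i) i
    simp only [Matrix.mul_apply (M := (G * regInv ε G)ᵀ), Matrix.sub_apply, Matrix.smul_apply,
      Matrix.transpose_apply, smul_eq_mul, Matrix.mul_apply (M := regInv ε G)] at h1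
    have h2 : 0 ≤ ∑ a, (G * regInv ε G) a i * (G * regInv ε G) a i :=
      Finset.sum_nonneg fun a _ => mul_self_nonneg _
    have h3 : regInv ε G i j ^ 2 ≤ ∑ k, regInv ε G i k * regInv ε G k i := by
      refine le_trans (le_of_eq ?_) (Finset.single_le_sum
        (f := fun k => regInv ε G i k * regInv ε G k i) (fun k _ => ?_) (Finset.mem_univ j))
      · rw [regInv_symm ε G j i, sq]
      · rw [regInv_symm ε G k i]; exact mul_self_nonneg _
    nlinarith
  have hd : 0 ≤ regInv ε G i i := (posSemidef_regInv hε.le G).diag_nonneg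
  have h1 : regInv ε G i i ≤ ε⁻¹ := by
    rw [← one_div, le_div_iff₀ hε]
    by_contra hc
    nlinarith [key i i]
  refine abs_le_of_sq_le_sq ?_ (inv_pos.2 hε).le
  have h2 : ε * regInv ε G i j ^ 2 ≤ ε⁻¹ := (key i j).trans h1
  calc regInv ε G i j ^ 2 = ε⁻¹ * (ε * regInv ε G i j ^ 2) := by field_simp
    _ ≤ ε⁻¹ * ε⁻¹ := mul_le_mul_of_nonneg_left h2 (inv_pos.2 hε).le
    _ = ε⁻¹ ^ 2 := (sq _).symm

lemma sq_mul_regInv_apply_le (hε : 0 < ε) (G : Matrix ρ ι ℝ) (a : ρ) (i : ι) :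
    (G * regInv ε G) a i ^ 2 ≤ ε⁻¹ := by
  have h1 := congrFun (congrFun (gram_mul_regInv_self (isUnit_det_gram_add hε G)) i) i
  simp only [Matrix.mul_apply (M := (G * regInv ε G)ᵀ), Matrix.sub_apply, Matrix.smul_apply,
      Matrix.transpose_apply, smul_eq_mul, Matrix.mul_apply (M := regInv ε G)] at h1
  have h2 : (G * regInv ε G) a i ^ 2 ≤ ∑ a, (G * regInv ε G) a i * (G * regInv ε G) a i := by
    rw [sq]
    exact Finset.single_le_sum (f := fun a => (G * regInv ε G) a i * (G * regInv ε G) a i)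
      (fun a _ => mul_self_nonneg _) (Finset.mem_univ a)
  have h3 : 0 ≤ ∑ k, regInv ε G i k * regInv ε G k i := Finset.sum_nonneg fun k _ => by
    rw [regInv_symm ε G k i]; exact mul_self_nonneg _
  have h4 := (abs_le.1 (abs_regInv_apply_le hε G i i)).2
  nlinarith

lemma abs_mul_regInv_apply_le (hε : 0 < ε) (G : Matrix ρ ι ℝ) (a : ρ) (i : ι) :
    |(G * regInv ε G) a i| ≤ ε⁻¹ + 1 := by
  have := sq_mul_regInv_apply_le hε G a i
  refine abs_le_of_sq_le_sq (this.trans ?_) (by positivity)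
  nlinarith [inv_pos.2 hε]

/-- `Q = G (Gᵀ G + ε)⁻¹ Gᵀ` satisfies `Q² = Q - ε N Nᵀ` with `N = G (Gᵀ G + ε)⁻¹`, so it is
bounded by the identity. -/
lemma abs_mul_regInv_mul_apply_le (hε : 0 < ε) (G : Matrix ρ ι ℝ) (a b : ρ) :
    |(G * regInv ε G * Gᵀ) a b| ≤ 1 := by
  set Q := G * regInv ε G * Gᵀ with hQ
  have hQt : Qᵀ = Q := by
    simp [hQ, Matrix.transpose_mul, regInv_transpose, Matrix.mul_assoc]
  have hQs : ∀ a b, Q a b = Q b a := fun a b => congrFun (congrFun hQt b) a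
  have hQQ : Q * Q = Q - ε • ((G * regInv ε G) * (G * regInv ε G)ᵀ) := by
    rw [Matrix.transpose_mul, regInv_transpose]
    calc Q * Q = G * (regInv ε G * (Gᵀ * G)) * regInv ε G * Gᵀ := by
          simp only [hQ, Matrix.mul_assoc]
      _ = _ := by
          rw [regInv_mul_gram (isUnit_det_gram_add hε G)]
          simp only [hQ, Matrix.mul_sub, Matrix.sub_mul, Matrix.mul_one, Matrix.mul_smul,
            Matrix.smul_mul, Matrix.mul_assoc]
  have key : ∀ a b, Q a b ^ 2 ≤ Q a a := fun a b => by
    have h1 := congrFun (congrFun hQQ a) a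
    simp only [Matrix.mul_apply (M := Q), Matrix.sub_apply, Matrix.smul_apply, smul_eq_mul,
      Matrix.mul_apply (M := G * regInv ε G), Matrix.transpose_apply] at h1
    have h2 : 0 ≤ ∑ i, (G * regInv ε G) a i * (G * regInv ε G) a i :=
      Finset.sum_nonneg fun a _ => mul_self_nonneg _
    have h3 : Q a b ^ 2 ≤ ∑ k, Q a k * Q k a := by
      refine le_trans (le_of_eq ?_) (Finset.single_le_sum
        (f := fun k => Q a k * Q k a) (fun k _ => ?_) (Finset.mem_univ b))
      · rw [hQs b a, sq]
      · rw [hQs k a]; exact mul_self_nonneg _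
    nlinarith
  have h1 : Q a a ≤ 1 := by
    by_contra hc
    nlinarith [key a a]
  exact abs_le_of_sq_le_sq (by linarith [key a b]) zero_le_one

end Bounds

section Derivatives

lemma mul_vecMulVec_mul_apply {ρ ι κ τ : Type*} [Fintype ρ] [Fintype ι] (A : Matrix κ ρ ℝ)
    (x : ρ → ℝ) (y : ι → ℝ) (B : Matrix ι τ ℝ) (k : κ) (l : τ) :
    (A * vecMulVec x y * B) k l = (∑ i, A k i * x i) * ∑ j, y j * B j l := by
  rw [Matrix.mul_vecMulVec, Matrix.vecMulVec_mul, vecMulVec_apply]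
  rfl

variable {ρ ι : Type*} [Fintype ρ] [DecidableEq ρ] [Fintype ι] [DecidableEq ι] {ε : ℝ}

lemma hasDerivAt_zero_of_sub_eq_mul {f g : ℝ → ℝ} (hfg : ∀ s, f s - f 0 = s * g s)
    (hg : ContinuousAt g 0) : HasDerivAt f (g 0) 0 := by
  rw [hasDerivAt_iff_tendsto_slope_zero]
  refine (hg.tendsto.mono_left nhdsWithin_le_nhds).congr' ?_
  filter_upwards [self_mem_nhdsWithin] with s hs
  rw [zero_add, hfg, smul_eq_mul, inv_mul_cancel_left₀ hs]

omit [DecidableEq ρ] in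
/-- The resolvent identity along the line `s ↦ G + s E`. -/
lemma regInv_add_smul_sub (hε : 0 < ε) (G E : Matrix ρ ι ℝ) (s : ℝ) :
    regInv ε (G + s • E) - regInv ε G =
      s • -(regInv ε (G + s • E) * (Eᵀ * G + Gᵀ * E + s • (Eᵀ * E)) * regInv ε G) := by
  have h1 := Matrix.nonsing_inv_mul _ (isUnit_det_gram_add hε (G + s • E))
  have h2 := Matrix.mul_nonsing_inv _ (isUnit_det_gram_add hε G)
  have h3 : s • (Eᵀ * G + Gᵀ * E + s • (Eᵀ * E))
      = ((G + s • E)ᵀ * (G + s • E) + ε • (1 : Matrix ι ι ℝ)) - (Gᵀ * G + ε • 1) := by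
    simp only [Matrix.transpose_add, Matrix.transpose_smul, Matrix.add_mul, Matrix.mul_add,
      Matrix.smul_mul, Matrix.mul_smul, smul_add]
    abel
  rw [smul_neg, ← Matrix.smul_mul, ← Matrix.mul_smul, h3, Matrix.mul_sub, Matrix.sub_mul]
  change _ = -(((G + s • E)ᵀ * (G + s • E) + ε • (1 : Matrix ι ι ℝ))⁻¹ * _ * _ - _ * _ *
    (Gᵀ * G + ε • (1 : Matrix ι ι ℝ))⁻¹)
  rw [h1, Matrix.mul_assoc, h2, Matrix.one_mul, Matrix.mul_one, neg_sub]

/-- The derivative `-M (Eᵀ G + Gᵀ E) M` of `M = (Gᵀ G + ε)⁻¹` along the matrix unit `E` at `(a, i)`,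
written with `N = G M` in place of the unbounded `G`. -/
lemma hasBoundedPartials_regInv (hε : 0 < ε) (k l : ι) :
    HasBoundedPartials (fun G : Matrix ρ ι ℝ => regInv ε G k l) (fun a i G =>
      -(regInv ε G k i * (G * regInv ε G) a l + (G * regInv ε G) a k * regInv ε G i l)) := by
  have hc := continuous_regInv (ρ := ρ) (ι := ι) hε
  refine ⟨hc.matrix_elem k l, fun a i => ?_, ⟨_, fun G => abs_regInv_apply_le hε G k l⟩,
    fun a i => ⟨ε⁻¹ * (ε⁻¹ + 1) + (ε⁻¹ + 1) * ε⁻¹, fun G => ?_⟩, fun a u G => ?_⟩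
  · have hN : Continuous fun G : Matrix ρ ι ℝ => G * regInv ε G := continuous_id.matrix_mul hc
    exact (((hc.matrix_elem k i).mul (hN.matrix_elem a l)).add
      ((hN.matrix_elem a k).mul (hc.matrix_elem i l))).neg
  · have hp := inv_pos.2 hε
    rw [abs_neg]
    refine (abs_add_le _ _).trans (add_le_add ?_ ?_) <;> rw [abs_mul]
    · exact mul_le_mul (abs_regInv_apply_le hε G _ _) (abs_mul_regInv_apply_le hε G _ _)
        (abs_nonneg _) hp.le
    · exact mul_le_mul (abs_mul_regInv_apply_le hε G _ _) (abs_regInv_apply_le hε G _ _)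
        (abs_nonneg _) (by positivity)
  · set E := vecMulVec (Pi.single a 1) u with hE
    have hd := hasDerivAt_zero_of_sub_eq_mul (f := fun s : ℝ => regInv ε (G + s • E) k l)
      (g := fun s => (-(regInv ε (G + s • E) * (Eᵀ * G + Gᵀ * E + s • (Eᵀ * E)) * regInv ε G)) k l)
      (fun s => by
        have := congrFun (congrFun (regInv_add_smul_sub hε G E s) k) l
        simpa using this) ?_
    · refine hd.congr_deriv ?_
      have e : regInv ε G * (Eᵀ * G + Gᵀ * E) * regInv ε G
          = regInv ε G * vecMulVec u (Pi.single a 1) * (G * regInv ε G)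
            + (G * regInv ε G)ᵀ * vecMulVec (Pi.single a 1) u * regInv ε G := by
        rw [hE, transpose_vecMulVec, Matrix.transpose_mul, regInv_transpose]
        simp only [Matrix.mul_add, Matrix.add_mul, Matrix.mul_assoc]
      simp only [zero_smul, add_zero, e, Matrix.neg_apply, Matrix.add_apply,
        mul_vecMulVec_mul_apply, Matrix.transpose_apply]
      simp only [Pi.single_apply, mul_ite, ite_mul, mul_one, one_mul, mul_zero, zero_mul,
        Finset.sum_ite_eq', Finset.mem_univ, if_true, neg_add, Finset.sum_mul, Finset.mul_sum,
        ← Finset.sum_neg_distrib, ← Finset.sum_add_distrib]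
      exact Finset.sum_congr rfl fun i _ => by ring
    · have hl : Continuous fun s : ℝ => regInv ε (G + s • E) := hc.comp (by fun_prop)
      have : Continuous fun s : ℝ =>
        -(regInv ε (G + s • E) * (Eᵀ * G + Gᵀ * E + s • (Eᵀ * E)) * regInv ε G) := by fun_prop
      exact (this.matrix_elem k l).continuousAt

/-- The partial derivatives of `N = G M`, written with the bounded `M`, `N` and `G M Gᵀ`. -/
lemma hasBoundedPartials_mul_regInv (hε : 0 < ε) (b : ρ) (l : ι) :
    HasBoundedPartials (fun G : Matrix ρ ι ℝ => (G * regInv ε G) b l) (fun a i G =>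
      (if a = b then regInv ε G i l else 0) - (G * regInv ε G) b i * (G * regInv ε G) a l
        - (G * regInv ε G * Gᵀ) b a * regInv ε G i l) := by
  have hc := continuous_regInv (ρ := ρ) (ι := ι) hε
  have hN : Continuous fun G : Matrix ρ ι ℝ => G * regInv ε G := continuous_id.matrix_mul hc
  have hQ : Continuous fun G : Matrix ρ ι ℝ => G * regInv ε G * Gᵀ :=
    hN.matrix_mul continuous_id.matrix_transpose
  have hp := inv_pos.2 hε
  refine ⟨hN.matrix_elem b l, fun a i => ?_, ⟨_, fun G => abs_mul_regInv_apply_le hε G b l⟩,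
    fun a i => ⟨ε⁻¹ + (ε⁻¹ + 1) * (ε⁻¹ + 1) + 1 * ε⁻¹, fun G => ?_⟩, fun a u G => ?_⟩
  · refine (Continuous.sub ?_ ((hN.matrix_elem b i).mul (hN.matrix_elem a l))).sub
      ((hQ.matrix_elem b a).mul (hc.matrix_elem i l))
    split_ifs
    · exact hc.matrix_elem i l
    · exact continuous_const
  · refine (abs_sub _ _).trans (add_le_add ((abs_sub _ _).trans (add_le_add ?_ ?_)) ?_)
    · split_ifs
      · exact abs_regInv_apply_le hε G _ _
      · simpa using hε.le
    · rw [abs_mul]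
      exact mul_le_mul (abs_mul_regInv_apply_le hε G _ _) (abs_mul_regInv_apply_le hε G _ _)
        (abs_nonneg _) (by positivity)
    · rw [abs_mul]
      exact mul_le_mul (abs_mul_regInv_mul_apply_le hε G _ _) (abs_regInv_apply_le hε G _ _)
        (abs_nonneg _) zero_le_one
  · set E := vecMulVec (Pi.single a 1) u with hE
    have hd := hasDerivAt_zero_of_sub_eq_mul
      (f := fun s : ℝ => ((G + s • E) * regInv ε (G + s • E)) b l)
      (g := fun s => (E * regInv ε (G + s • E)
        - G * (regInv ε (G + s • E) * (Eᵀ * G + Gᵀ * E + s • (Eᵀ * E)) * regInv ε G)) b l)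
      (fun s => by
        have h1 : (G + s • E) * regInv ε (G + s • E) - G * regInv ε G
            = s • (E * regInv ε (G + s • E)) +
              G * (regInv ε (G + s • E) - regInv ε G) := by
          rw [Matrix.add_mul, Matrix.mul_sub, Matrix.smul_mul]
          abel
        rw [regInv_add_smul_sub hε G E s, Matrix.mul_smul, ← smul_add, Matrix.mul_neg,
          ← sub_eq_add_neg] at h1
        have := congrFun (congrFun h1 b) l
        simpa using this) ?_
    · refine hd.congr_deriv ?_
      have e : E * regInv ε G - G * (regInv ε G * (Eᵀ * G + Gᵀ * E) * regInv ε G)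
          = (1 : Matrix ρ ρ ℝ) * vecMulVec (Pi.single a 1) u * regInv ε G
            - G * regInv ε G * vecMulVec u (Pi.single a 1) * (G * regInv ε G)
            - G * regInv ε G * Gᵀ * vecMulVec (Pi.single a 1) u * regInv ε G := by
        rw [hE, transpose_vecMulVec]
        simp only [Matrix.mul_add, Matrix.add_mul, Matrix.mul_assoc, Matrix.one_mul]
        abel
      simp only [zero_smul, add_zero]
      rw [e]
      simp only [Matrix.sub_apply, mul_vecMulVec_mul_apply]
      simp only [Pi.single_apply, mul_ite, ite_mul, mul_one, one_mul, mul_zero, zero_mul,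
        Finset.sum_ite_eq', Finset.mem_univ, if_true, Finset.sum_mul, Finset.mul_sum,
        ← Finset.sum_sub_distrib, Matrix.one_apply]
      refine Finset.sum_congr rfl fun i _ => ?_
      by_cases hab : a = b
      · subst hab; simp; ring
      · simp [hab, Ne.symm hab]; ring
    · have hl : Continuous fun s : ℝ => regInv ε (G + s • E) := hc.comp (by fun_prop)
      have : Continuous fun s : ℝ => E * regInv ε (G + s • E)
        - G * (regInv ε (G + s • E) * (Eᵀ * G + Gᵀ * E + s • (Eᵀ * E)) * regInv ε G) := by
        fun_prop
      exact (this.matrix_elem b l).continuousAt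

end Derivatives

/-! ### Three instances of Stein's identity -/

section SteinIdentities

variable {ρ ι : Type*} [Fintype ρ] [DecidableEq ρ] [Fintype ι] [DecidableEq ι]

/-- The matrix of the expressions `∑ a, (G a i * F a j - v * ∂F a j / ∂G a i)`, whose means
vanish by Stein's identity, for `F = G M` and `M = (Gᵀ G + ε)⁻¹`, written as a function of `M`.
Here `v` is the variance of the entries of the `m × d` matrix `G` and `x = m - d`. -/
noncomputable def steinFirst (v x ε : ℝ) (M : Matrix ι ι ℝ) : Matrix ι ι ℝ :=
  1 - ε • M - v • ((x - 1) • M + ε • (M * M) + (ε * M.trace) • M)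

/-- The analogue of `steinFirst` for `F = G M²`. -/
noncomputable def steinSecond (v x ε : ℝ) (M : Matrix ι ι ℝ) : Matrix ι ι ℝ :=
  M - ε • (M * M) - v • ((x - 2) • (M * M) - M.trace • M + (2 * ε) • (M * M * M)
    + (ε * M.trace) • (M * M) + (ε * (M * M).trace) • M)

/-- The analogue of `steinFirst` for `F = tr(M) G M`. -/
noncomputable def steinThird (v x ε : ℝ) (M : Matrix ι ι ℝ) : Matrix ι ι ℝ :=
  M.trace • (1 - ε • M) - v • (((x - 1) * M.trace) • M + (ε * M.trace) • (M * M)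
    + (ε * M.trace ^ 2) • M - (2 : ℝ) • (M * M) + (2 * ε) • (M * M * M))

variable {ε : ℝ}

omit [DecidableEq ρ] in
lemma sum_entry_mul_mul_regInv (hε : 0 < ε) (G : Matrix ρ ι ℝ) (i j : ι) :
    ∑ a, G a i * (G * regInv ε G) a j = (1 - ε • regInv ε G) i j := by
  rw [← gram_mul_regInv (isUnit_det_gram_add hε G), Matrix.mul_assoc]
  rfl

omit [DecidableEq ρ] in
lemma sum_mul_regInv_mul_mul_regInv (hε : 0 < ε) (G : Matrix ρ ι ℝ) (i j : ι) :
    ∑ a, (G * regInv ε G) a i * (G * regInv ε G) a j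
      = (regInv ε G - ε • (regInv ε G * regInv ε G)) i j := by
  rw [← gram_mul_regInv_self (isUnit_det_gram_add hε G)]
  rfl

omit [DecidableEq ρ] in
lemma sum_mul_regInv_mul_diag (hε : 0 < ε) (G : Matrix ρ ι ℝ) :
    ∑ a, (G * regInv ε G * Gᵀ) a a = Fintype.card ι - ε * (regInv ε G).trace := by
  rw [← trace_mul_regInv_mul (isUnit_det_gram_add hε G)]
  rfl

variable {Ω ν : Type*} [MeasurableSpace Ω] {P : Measure Ω} [IsProbabilityMeasure P]
  [Fintype ν] [DecidableEq ν] {v : ℝ≥0} {S : Ω → Matrix ρ ν ℝ} {U : Matrix ν ι ℝ}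

section

variable (hv : v ≠ 0) (hSm : ∀ a j, Measurable fun ω => S ω a j)
  (hS : ∀ a j, HasLaw (fun ω => S ω a j) (gaussianReal 0 v) P)
  (hind : iIndepFun (fun (c : ρ × ν) ω => S ω c.1 c.2) P) (hU : Uᵀ * U = 1) (hε : 0 < ε)
include hv hSm hS hind hU hε

lemma integral_steinFirst_eq_zero (i j : ι) :
    Integrable (fun ω => steinFirst v (Fintype.card ρ - Fintype.card ι) ε
      (regInv ε (S ω * U)) i j) P ∧
    ∫ ω, steinFirst v (Fintype.card ρ - Fintype.card ι) ε (regInv ε (S ω * U)) i j ∂P = 0 := by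
  have h := integral_sum_entry_mul_sub_eq_zero hv hSm hS hind hU
    (fun a => hasBoundedPartials_mul_regInv (ρ := ρ) (ι := ι) hε a j) i
  convert h using 4 with ω ω
  all_goals
    have hP := sum_mul_regInv_mul_mul_regInv hε (S ω * U)
    have hq := sum_mul_regInv_mul_diag hε (S ω * U)
    have hG := sum_entry_mul_mul_regInv hε (S ω * U)
    generalize S ω * U = G at *
    simp only [if_true, Finset.sum_sub_distrib, ← Finset.sum_mul, hP, hq, hG, Finset.sum_const,
      Finset.card_univ, nsmul_eq_mul]
    simp only [steinFirst, Matrix.sub_apply, Matrix.add_apply, Matrix.smul_apply, smul_eq_mul]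
    ring

lemma integral_steinSecond_eq_zero (i j : ι) :
    Integrable (fun ω => steinSecond v (Fintype.card ρ - Fintype.card ι) ε
      (regInv ε (S ω * U)) i j) P ∧
    ∫ ω, steinSecond v (Fintype.card ρ - Fintype.card ι) ε (regInv ε (S ω * U)) i j ∂P = 0 := by
  have h := integral_sum_entry_mul_sub_eq_zero hv hSm hS hind hU
    (fun a => HasBoundedPartials.sum fun l =>
      (hasBoundedPartials_mul_regInv (ρ := ρ) (ι := ι) hε a l).mul
        (hasBoundedPartials_regInv hε l j)) i
  have key : ∀ G : Matrix ρ ι ℝ, steinSecond v (Fintype.card ρ - Fintype.card ι) ε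
      (regInv ε G) i j = ∑ a, G a i * ∑ l, (G * regInv ε G) a l * regInv ε G l j
        - v * ∑ a, ∑ l, ((regInv ε G i l
          - (G * regInv ε G) a i * (G * regInv ε G) a l
          - (G * regInv ε G * Gᵀ) a a * regInv ε G i l) * regInv ε G l j
          + (G * regInv ε G) a l * -(regInv ε G l i * (G * regInv ε G) a j
            + (G * regInv ε G) a l * regInv ε G i j)) := by
    intro G
    have hP := sum_mul_regInv_mul_mul_regInv hε G
    have hq := sum_mul_regInv_mul_diag hε G
    have hG := sum_entry_mul_mul_regInv hε G
    have hs := regInv_symm ε G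
    have e1 : ∑ a, G a i * ∑ l, (G * regInv ε G) a l * regInv ε G l j
        = ((1 - ε • regInv ε G) * regInv ε G) i j := by
      rw [Matrix.mul_apply]
      simp only [Finset.mul_sum, ← hG, Finset.sum_mul]
      rw [Finset.sum_comm]
      exact Finset.sum_congr rfl fun _ _ => Finset.sum_congr rfl fun _ _ => by ring
    have e2 : ∑ a, ∑ l, ((regInv ε G i l
          - (G * regInv ε G) a i * (G * regInv ε G) a l
          - (G * regInv ε G * Gᵀ) a a * regInv ε G i l) * regInv ε G l j
          + (G * regInv ε G) a l * -(regInv ε G l i * (G * regInv ε G) a j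
            + (G * regInv ε G) a l * regInv ε G i j))
        = ∑ l, ((∑ _a : ρ, (1 : ℝ)) * (regInv ε G i l * regInv ε G l j)
          - (∑ a, (G * regInv ε G) a i * (G * regInv ε G) a l) * regInv ε G l j
          - (∑ a, (G * regInv ε G * Gᵀ) a a) * (regInv ε G i l * regInv ε G l j)
          - regInv ε G i l * (∑ a, (G * regInv ε G) a l * (G * regInv ε G) a j)
          - (∑ a, (G * regInv ε G) a l * (G * regInv ε G) a l) * regInv ε G i j) := by
      rw [Finset.sum_comm]
      refine Finset.sum_congr rfl fun l _ => ?_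
      simp only [Finset.sum_mul, Finset.mul_sum, ← Finset.sum_sub_distrib]
      refine Finset.sum_congr rfl fun a _ => ?_
      rw [hs l i]
      ring
    rw [e1, e2]
    simp only [hP, hq, Finset.sum_sub_distrib, ← Finset.mul_sum, ← Finset.sum_mul]
    have htr : ∀ X : Matrix ι ι ℝ, ∑ l, X l l = X.trace := fun _ => rfl
    simp only [← Matrix.mul_apply, htr]
    simp only [steinSecond, Matrix.sub_mul, Matrix.mul_sub, Matrix.sub_apply, Matrix.add_apply,
      Matrix.smul_apply, smul_eq_mul, Matrix.smul_mul, Matrix.mul_smul, Matrix.one_mul,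
      Matrix.trace_sub, Matrix.trace_smul, Finset.sum_const, Finset.card_univ, nsmul_eq_mul,
      Matrix.mul_assoc]
    ring
  simp only [if_true] at h
  simp only [key]
  exact h

lemma integral_steinThird_eq_zero (i j : ι) :
    Integrable (fun ω => steinThird v (Fintype.card ρ - Fintype.card ι) ε
      (regInv ε (S ω * U)) i j) P ∧
    ∫ ω, steinThird v (Fintype.card ρ - Fintype.card ι) ε (regInv ε (S ω * U)) i j ∂P = 0 := by
  have h := integral_sum_entry_mul_sub_eq_zero hv hSm hS hind hU
    (fun a => (HasBoundedPartials.sum fun l => hasBoundedPartials_regInv (ρ := ρ) hε l l).mul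
      (hasBoundedPartials_mul_regInv (ρ := ρ) (ι := ι) hε a j)) i
  have key : ∀ G : Matrix ρ ι ℝ, steinThird v (Fintype.card ρ - Fintype.card ι) ε
      (regInv ε G) i j = ∑ a, G a i * ((∑ l, regInv ε G l l) * (G * regInv ε G) a j)
        - v * ∑ a, ((∑ l, -(regInv ε G l i * (G * regInv ε G) a l
            + (G * regInv ε G) a l * regInv ε G i l)) * (G * regInv ε G) a j
          + (∑ l, regInv ε G l l) * (regInv ε G i j
          - (G * regInv ε G) a i * (G * regInv ε G) a j
          - (G * regInv ε G * Gᵀ) a a * regInv ε G i j)) := by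
    intro G
    have hP := sum_mul_regInv_mul_mul_regInv hε G
    have hq := sum_mul_regInv_mul_diag hε G
    have hG := sum_entry_mul_mul_regInv hε G
    have hs := regInv_symm ε G
    have e1 : ∑ a, G a i * ((∑ l, regInv ε G l l) * (G * regInv ε G) a j)
        = (regInv ε G).trace * (1 - ε • regInv ε G) i j := by
      rw [← hG, Finset.mul_sum]
      exact Finset.sum_congr rfl fun a _ => by rw [Matrix.trace]; simp only [Matrix.diag]; ring
    have e2 : ∑ a, ((∑ l, -(regInv ε G l i * (G * regInv ε G) a l
            + (G * regInv ε G) a l * regInv ε G i l)) * (G * regInv ε G) a j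
          + (∑ l, regInv ε G l l) * (regInv ε G i j
          - (G * regInv ε G) a i * (G * regInv ε G) a j
          - (G * regInv ε G * Gᵀ) a a * regInv ε G i j))
        = -2 * ∑ l, regInv ε G i l * (∑ a, (G * regInv ε G) a l * (G * regInv ε G) a j)
          + (regInv ε G).trace * ((∑ _a : ρ, (1 : ℝ)) * regInv ε G i j
            - (∑ a, (G * regInv ε G) a i * (G * regInv ε G) a j)
            - (∑ a, (G * regInv ε G * Gᵀ) a a) * regInv ε G i j) := by
      rw [Finset.sum_add_distrib]
      congr 1
      · simp only [Finset.sum_mul, Finset.mul_sum]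
        rw [Finset.sum_comm]
        refine Finset.sum_congr rfl fun l _ => Finset.sum_congr rfl fun a _ => ?_
        rw [hs l i]
        ring
      · rw [← Finset.mul_sum]
        refine congrArg (fun z => (regInv ε G).trace * z) ?_
        simp only [Finset.sum_mul, ← Finset.sum_sub_distrib, one_mul]
    rw [e1, e2]
    simp only [hP, hq]
    simp only [← Matrix.mul_apply]
    simp only [steinThird, Matrix.mul_sub, Matrix.sub_apply, Matrix.add_apply,
      Matrix.smul_apply, smul_eq_mul, Matrix.mul_smul, Finset.sum_const, Finset.card_univ,
      nsmul_eq_mul, Matrix.mul_assoc]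
    ring
  simp only [if_true] at h
  simp only [key]
  exact h

end

end SteinIdentities

/-! ### Trace estimates for the regularized inverse -/

section Moments

variable {ρ ι : Type*} [Fintype ρ] [Fintype ι] [DecidableEq ι] {ε : ℝ}

lemma trace_regInv_nonneg (hε : 0 ≤ ε) (G : Matrix ρ ι ℝ) : 0 ≤ (regInv ε G).trace :=
  (posSemidef_regInv hε G).trace_nonneg

lemma trace_regInv_mul_self_nonneg (hε : 0 ≤ ε) (G : Matrix ρ ι ℝ) :
    0 ≤ (regInv ε G * regInv ε G).trace := by
  have h := ((posSemidef_regInv hε G).pow 2).trace_nonneg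
  rwa [pow_two] at h

lemma trace_regInv_mul_self_mul_self_nonneg (hε : 0 ≤ ε) (G : Matrix ρ ι ℝ) :
    0 ≤ (regInv ε G * regInv ε G * regInv ε G).trace := by
  have h := ((posSemidef_regInv hε G).pow 3).trace_nonneg
  rwa [pow_three'] at h

lemma mul_trace_regInv_le (hε : 0 < ε) (G : Matrix ρ ι ℝ) :
    ε * (regInv ε G).trace ≤ Fintype.card ι := by
  have h := trace_mul_regInv_mul (isUnit_det_gram_add hε G)
  have h' := ((posSemidef_regInv hε.le G).mul_mul_conjTranspose_same G).trace_nonneg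
  rw [Matrix.conjTranspose_eq_transpose_of_trivial, h] at h'
  linarith

/-- `tr (Gᵀ G + ε)⁻¹` increases to `tr (Gᵀ G)⁻¹` as `ε` decreases to `0`: the difference is
`ε tr ((Gᵀ G)⁻¹ (Gᵀ G + ε)⁻¹) ≥ 0`. -/
lemma trace_regInv_le (hε : 0 < ε) {G : Matrix ρ ι ℝ} (hG : IsUnit (Gᵀ * G).det) :
    (regInv ε G).trace ≤ (regInv 0 G).trace := by
  have hG' : IsUnit (Gᵀ * G + (0 : ℝ) • (1 : Matrix ι ι ℝ)).det := by simpa using hG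
  have h1 : regInv 0 G * (Gᵀ * G) = 1 := by simpa using regInv_mul_gram hG'
  have h2 := gram_mul_regInv (isUnit_det_gram_add hε G)
  have h3 : regInv 0 G - regInv ε G = ε • (regInv 0 G * regInv ε G) := by
    have : regInv 0 G * (Gᵀ * G * regInv ε G) = regInv ε G := by
      rw [← Matrix.mul_assoc, h1, Matrix.one_mul]
    rw [h2, Matrix.mul_sub, Matrix.mul_one, Matrix.mul_smul] at this
    rw [sub_eq_iff_eq_add] at this ⊢
    rwa [add_comm]
  have h4 : regInv 0 G = (G * regInv 0 G)ᵀ * (G * regInv 0 G) := by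
    rw [gram_mul_regInv_self hG', zero_smul, sub_zero]
  have h5 : 0 ≤ (regInv 0 G * regInv ε G).trace := by
    rw [h4, Matrix.mul_assoc, Matrix.trace_mul_comm]
    have := ((posSemidef_regInv hε.le G).mul_mul_conjTranspose_same (G * regInv 0 G)).trace_nonneg
    rwa [Matrix.conjTranspose_eq_transpose_of_trivial] at this
  have h6 := congrArg Matrix.trace h3
  rw [Matrix.trace_sub, Matrix.trace_smul, smul_eq_mul] at h6
  nlinarith [mul_nonneg hε.le h5]

/-- At a singular Gram matrix the trace of the regularized inverse blows up like `1 / ε`. -/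
lemma tendsto_trace_regInv_atTop {G : Matrix ρ ι ℝ} (hG : ¬ IsUnit (Gᵀ * G).det) :
    Filter.Tendsto (fun ε => (regInv ε G).trace) (nhdsWithin 0 (Set.Ioi 0)) Filter.atTop := by
  rw [isUnit_iff_ne_zero, not_not] at hG
  obtain ⟨w, hw0, hw⟩ := Matrix.exists_mulVec_eq_zero_iff.2 hG
  obtain ⟨i, hi⟩ := Function.ne_iff.1 hw0
  have hi' : 0 < |w i| := abs_pos.2 hi
  have hs : 0 < ∑ j, |w j| :=
    hi'.trans_le (Finset.single_le_sum (f := fun j => |w j|) (fun j _ => abs_nonneg _)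
      (Finset.mem_univ i))
  have key : ∀ ε : ℝ, 0 < ε → (|w i| / ∑ j, |w j|) * ε⁻¹ ≤ (regInv ε G).trace := fun ε hε => by
    have h1 : regInv ε G *ᵥ (ε • w) = w := by
      have : (Gᵀ * G + ε • (1 : Matrix ι ι ℝ)) *ᵥ w = ε • w := by
        rw [Matrix.add_mulVec, hw, zero_add, Matrix.smul_mulVec, Matrix.one_mulVec]
      rw [← this, regInv, Matrix.mulVec_mulVec, Matrix.nonsing_inv_mul _ (isUnit_det_gram_add hε G),
        Matrix.one_mulVec]
    have h2 : |w i| ≤ ∑ j, (regInv ε G).trace * (ε * |w j|) := by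
      conv_lhs => rw [← h1]
      refine (Finset.abs_sum_le_sum_abs _ _).trans (Finset.sum_le_sum fun j _ => ?_)
      rw [abs_mul, Pi.smul_apply, smul_eq_mul, abs_mul, abs_of_pos hε]
      exact mul_le_mul_of_nonneg_right (abs_apply_le_trace (posSemidef_regInv hε.le G) i j)
        (by positivity)
    rw [← Finset.mul_sum, ← Finset.mul_sum] at h2
    rw [← div_eq_mul_inv, div_div, div_le_iff₀ (by positivity)]
    linarith
  refine Filter.tendsto_atTop_mono' _ ?_
    (Filter.Tendsto.const_mul_atTop (div_pos hi' hs) tendsto_inv_nhdsGT_zero)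
  filter_upwards [self_mem_nhdsWithin] with ε hε using key ε hε

lemma measurable_regInv_apply {Ω ν : Type*} [MeasurableSpace Ω] [Fintype ν] {S : Ω → Matrix ρ ν ℝ}
    (hS : ∀ a j, Measurable fun ω => S ω a j) (U : Matrix ν ι ℝ) (ε : ℝ) (i j : ι) :
    Measurable fun ω => regInv ε (S ω * U) i j := by
  have hH : Continuous fun T : Matrix ρ ν ℝ =>
      (T * U)ᵀ * (T * U) + ε • (1 : Matrix ι ι ℝ) := by fun_prop
  simp only [regInv, Matrix.inv_def, Ring.inverse_eq_inv', Matrix.smul_apply, smul_eq_mul]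
  exact (measurable_continuous_comp_matrix hS hH.matrix_det).inv.mul
    (measurable_continuous_comp_matrix hS (hH.matrix_adjugate.matrix_elem i j))

/-- The terms of `steinFirst` that carry a factor `ε` have the favourable sign, so the trace of the
identity bounds the mean of `tr M`. -/
lemma trace_steinFirst_le (hε : 0 < ε) {v x : ℝ} (hv : 0 ≤ v) (G : Matrix ρ ι ℝ) :
    (steinFirst v x ε (regInv ε G)).trace + v * (x - 1) * (regInv ε G).trace
      ≤ Fintype.card ι := by
  have h1 := trace_regInv_nonneg hε.le G
  have h2 := trace_regInv_mul_self_nonneg hε.le G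
  simp only [steinFirst, Matrix.trace_sub, Matrix.trace_add, Matrix.trace_smul, Matrix.trace_one,
    smul_eq_mul]
  have e1 := mul_nonneg hε.le h1
  have e2 := mul_nonneg hv (mul_nonneg hε.le h2)
  have e3 := mul_nonneg hv (mul_nonneg e1 h1)
  linarith

/-- The combination `(x - 2) · steinThird + 2 · steinSecond` eliminates `tr M²`, and the remaining
terms with a factor `ε` have the favourable sign, so its trace bounds the mean of `(tr M)²`. -/
lemma trace_steinThird_add_steinSecond_le (hε : 0 < ε) {v x : ℝ} (hv : 0 ≤ v) (hx : 2 ≤ x)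
    (G : Matrix ρ ι ℝ) :
    (x - 2) * (steinThird v x ε (regInv ε G)).trace
        + 2 * (steinSecond v x ε (regInv ε G)).trace + v * (x * (x - 3)) * (regInv ε G).trace ^ 2
      ≤ ((x - 2) * Fintype.card ι + 2) * (regInv ε G).trace := by
  have h1 := trace_regInv_nonneg hε.le G
  have h2 := trace_regInv_mul_self_nonneg hε.le G
  have h3 := trace_regInv_mul_self_mul_self_nonneg hε.le G
  simp only [steinSecond, steinThird, Matrix.trace_sub, Matrix.trace_add, Matrix.trace_smul,
    Matrix.trace_one, smul_eq_mul]
  generalize (regInv ε G).trace = a at *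
  generalize (regInv ε G * regInv ε G).trace = b at *
  generalize (regInv ε G * regInv ε G * regInv ε G).trace = c at *
  have hx' : 0 ≤ x - 2 := by linarith
  have hvε := mul_nonneg hv hε.le
  have e1 : 0 ≤ (x - 2) * (ε * (a * a)) := by positivity
  have e2 : 0 ≤ ε * b := by positivity
  have e3 : 0 ≤ v * ε * (a * b) := by positivity
  have e4 : 0 ≤ v * ε * c := by positivity
  have e5 : 0 ≤ (x - 2) * (v * ε * (a * b)) := by positivity
  have e6 : 0 ≤ (x - 2) * (v * ε * (a ^ 3)) := by positivity
  have e7 : 0 ≤ (x - 2) * (v * ε * c) := by positivity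
  linarith

end Moments

/-! ### Domination uniform in the regularization -/

section Domination

open Asymptotics Filter

variable {ρ ι : Type*} [Fintype ρ] [Fintype ι] [DecidableEq ι]

/-- The integrands of Stein's identities are dominated, uniformly in `ε ∈ (0, 1]`, by
`1 + (tr (Gᵀ G)⁻¹)²`. -/
lemma exists_abs_stein_le (v x : ℝ) (i j : ι) : ∃ C : ℝ, ∀ ε : ℝ, 0 < ε → ε ≤ 1 →
    ∀ G : Matrix ρ ι ℝ, IsUnit (Gᵀ * G).det →
      |steinFirst v x ε (regInv ε G) i j| ≤ C * (1 + (regInv 0 G).trace ^ 2) ∧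
      |steinSecond v x ε (regInv ε G) i j| ≤ C * (1 + (regInv 0 G).trace ^ 2) ∧
      |steinThird v x ε (regInv ε G) i j| ≤ C * (1 + (regInv 0 G).trace ^ 2) := by
  let l : Filter (ℝ × Matrix ρ ι ℝ) :=
    𝓟 {p | 0 < p.1 ∧ p.1 ≤ 1 ∧ IsUnit (p.2ᵀ * p.2).det}
  let M : ℝ × Matrix ρ ι ℝ → Matrix ι ι ℝ := fun p => regInv p.1 p.2
  let T : ℝ × Matrix ρ ι ℝ → ℝ := fun p => (regInv 0 p.2).trace
  let D : ℝ × Matrix ρ ι ℝ → ℝ := fun p => 1 + T p ^ 2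
  let one : ℝ × Matrix ρ ι ℝ → ℝ := fun _ => 1
  have hT0 : ∀ p, 0 ≤ T p := fun p => trace_regInv_nonneg le_rfl p.2
  have bd : ∀ (f g : ℝ × Matrix ρ ι ℝ → ℝ) (C : ℝ),
      (∀ p : ℝ × Matrix ρ ι ℝ, 0 < p.1 → p.1 ≤ 1 → IsUnit (p.2ᵀ * p.2).det →
        |f p| ≤ C * |g p|) → f =O[l] g := fun f g C h =>
    isBigO_principal.2 ⟨C, fun p hp => h p hp.1 hp.2.1 hp.2.2⟩
  have htr : (fun p => (M p).trace) =O[l] T := bd _ _ 1 fun p h1 _ h3 => by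
    rw [one_mul, abs_of_nonneg (trace_regInv_nonneg h1.le p.2), abs_of_nonneg (hT0 p)]
    exact trace_regInv_le h1 h3
  have hM : ∀ i j, (fun p => M p i j) =O[l] T := fun i j => bd _ _ 1 fun p h1 _ h3 => by
    rw [one_mul, abs_of_nonneg (hT0 p)]
    exact (abs_apply_le_trace (posSemidef_regInv h1.le p.2) i j).trans (trace_regInv_le h1 h3)
  have hεM : ∀ i j, (fun p => p.1 * M p i j) =O[l] one := fun i j =>
    bd _ _ (Fintype.card ι) fun p h1 _ h3 => by
      rw [abs_mul, abs_of_pos h1, abs_one, mul_one]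
      exact (mul_le_mul_of_nonneg_left (abs_apply_le_trace (posSemidef_regInv h1.le p.2) i j)
        h1.le).trans (mul_trace_regInv_le h1 p.2)
  have hετ : (fun p => p.1 * (M p).trace) =O[l] one := bd _ _ (Fintype.card ι) fun p h1 _ h3 => by
    rw [abs_of_nonneg (mul_nonneg h1.le (trace_regInv_nonneg h1.le p.2)), abs_one, mul_one]
    exact mul_trace_regInv_le h1 p.2
  have h1D : one =O[l] D := bd _ _ 1 fun p _ _ _ => by
    rw [abs_one, one_mul, abs_of_nonneg (by positivity)]
    exact le_add_of_nonneg_right (sq_nonneg _)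
  have hTD : T =O[l] D := bd _ _ 1 fun p _ _ _ => by
    rw [one_mul, abs_of_nonneg (hT0 p), abs_of_nonneg (by positivity)]
    nlinarith [sq_nonneg (T p - 1)]
  have hTT : (fun p => T p * T p) =O[l] D := bd _ _ 1 fun p _ _ _ => by
    rw [one_mul, abs_of_nonneg (mul_nonneg (hT0 p) (hT0 p)), abs_of_nonneg (by positivity)]
    nlinarith
  have hMM : ∀ i j, (fun p => (M p * M p) i j) =O[l] fun p => T p * T p := fun i j => by
    simp only [Matrix.mul_apply]
    exact IsBigO.fun_sum fun k _ => (hM i k).mul (hM k j)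
  have htrMM : (fun p => (M p * M p).trace) =O[l] fun p => T p * T p :=
    IsBigO.fun_sum fun k _ => hMM k k
  have hεMM : ∀ i j, (fun p => p.1 * (M p * M p) i j) =O[l] T := fun i j => by
    simp only [Matrix.mul_apply, Finset.mul_sum, ← mul_assoc]
    exact IsBigO.fun_sum fun k _ => by simpa [one] using (hεM i k).mul (hM k j)
  have hεMMM : ∀ i j, (fun p => p.1 * (M p * M p * M p) i j) =O[l] fun p => T p * T p :=
    fun i j => by
      simp only [Matrix.mul_assoc (M _)]
      simp only [Matrix.mul_apply (M := M _) (N := M _ * M _), Finset.mul_sum, ← mul_assoc]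
      exact IsBigO.fun_sum fun k _ => by simpa [one] using (hεM i k).mul (hMM k j)
  have hετM : ∀ i j, (fun p => p.1 * (M p).trace * M p i j) =O[l] T := fun i j => by
    simpa [one] using hετ.mul (hM i j)
  have hετMM : ∀ i j, (fun p => p.1 * (M p).trace * (M p * M p) i j) =O[l] fun p => T p * T p :=
    fun i j => by simpa [one] using hετ.mul (hMM i j)
  have hετ2M : ∀ i j, (fun p => p.1 * (M p).trace ^ 2 * M p i j) =O[l] fun p => T p * T p :=
    fun i j => by
      have := (hετ.mul htr).mul (hM i j)
      simp only [one, one_mul] at this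
      exact this.congr_left fun p => by ring
  have hετrM : ∀ i j, (fun p => p.1 * (M p * M p).trace * M p i j) =O[l] fun p => T p * T p :=
    fun i j => by
      have := htrMM.mul (hεM i j)
      simp only [one, mul_one] at this
      exact this.congr_left fun p => by ring
  have hτM : ∀ i j, (fun p => (M p).trace * M p i j) =O[l] fun p => T p * T p :=
    fun i j => htr.mul (hM i j)
  have h1ij : (fun _ : ℝ × Matrix ρ ι ℝ => (1 : Matrix ι ι ℝ) i j) =O[l] one :=
    isBigO_const_const _ one_ne_zero _
  have f1 : (fun p : ℝ × Matrix ρ ι ℝ => steinFirst v x p.1 (M p) i j) =O[l] D := by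
    simp only [steinFirst, Matrix.sub_apply, Matrix.add_apply, Matrix.smul_apply, smul_eq_mul]
    exact ((h1ij.trans h1D).sub ((hεM i j).trans h1D)).sub
      ((((((hM i j).const_mul_left (x - 1)).add (hεMM i j)).add
        (hετM i j)).trans hTD).const_mul_left v)
  have f2 : (fun p : ℝ × Matrix ρ ι ℝ => steinSecond v x p.1 (M p) i j) =O[l] D := by
    simp only [steinSecond, Matrix.sub_apply, Matrix.add_apply, Matrix.smul_apply, smul_eq_mul]
    refine (((hM i j).sub (hεMM i j)).trans hTD).sub
      ((((((((hMM i j).const_mul_left (x - 2)).sub (hτM i j)).add ?_).add (hετMM i j)).add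
        (hετrM i j)).trans hTT).const_mul_left v)
    simpa only [mul_assoc] using (hεMMM i j).const_mul_left 2
  have f3 : (fun p : ℝ × Matrix ρ ι ℝ => steinThird v x p.1 (M p) i j) =O[l] D := by
    simp only [steinThird, Matrix.sub_apply, Matrix.add_apply, Matrix.smul_apply, smul_eq_mul,
      mul_sub]
    refine IsBigO.sub (IsBigO.sub ?_ ?_) ?_
    · simpa [one] using (htr.mul h1ij).trans (by simpa [one] using hTD)
    · have := (hετM i j).trans hTD
      exact this.congr_left fun p => by ring
    · refine (((((IsBigO.add ?_ (hετMM i j)).add (hετ2M i j)).sub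
        ((hMM i j).const_mul_left 2)).add ?_).trans hTT).const_mul_left v
      · simpa only [mul_assoc] using (hτM i j).const_mul_left (x - 1)
      · simpa only [mul_assoc] using (hεMMM i j).const_mul_left 2
  obtain ⟨C₁, h₁⟩ := isBigO_principal.1 f1
  obtain ⟨C₂, h₂⟩ := isBigO_principal.1 f2
  obtain ⟨C₃, h₃⟩ := isBigO_principal.1 f3
  refine ⟨max C₁ (max C₂ C₃), fun ε h1 h2 G hG => ?_⟩
  have hD : ‖D (ε, G)‖ = 1 + (regInv 0 G).trace ^ 2 := by
    rw [Real.norm_of_nonneg (by positivity)]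
  have hD0 : 0 ≤ 1 + (regInv 0 G).trace ^ 2 := by positivity
  have g₁ := h₁ (ε, G) ⟨h1, h2, hG⟩
  have g₂ := h₂ (ε, G) ⟨h1, h2, hG⟩
  have g₃ := h₃ (ε, G) ⟨h1, h2, hG⟩
  rw [hD] at g₁ g₂ g₃
  exact ⟨g₁.trans (mul_le_mul_of_nonneg_right (le_max_left _ _) hD0),
    g₂.trans (mul_le_mul_of_nonneg_right ((le_max_left _ _).trans (le_max_right _ _)) hD0),
    g₃.trans (mul_le_mul_of_nonneg_right ((le_max_right _ _).trans (le_max_right _ _)) hD0)⟩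

end Domination

/-! ### Moments of the inverse Gram matrix of a Gaussian matrix -/

section InverseMoments

open Filter

variable {ρ ι : Type*} [Fintype ρ] [DecidableEq ρ] [Fintype ι] [DecidableEq ι]
  {Ω ν : Type*} [MeasurableSpace Ω] {P : Measure Ω} [IsProbabilityMeasure P]
  [Fintype ν] [DecidableEq ν] {v : ℝ≥0} {S : Ω → Matrix ρ ν ℝ} {U : Matrix ν ι ℝ}

omit [DecidableEq ρ] [IsProbabilityMeasure P] [DecidableEq ν] in
lemma measurable_trace_regInv (hSm : ∀ a j, Measurable fun ω => S ω a j) (ε : ℝ) :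
    Measurable fun ω => (regInv ε (S ω * U)).trace :=
  Finset.measurable_sum _ fun i _ => measurable_regInv_apply hSm U ε i i

omit [DecidableEq ρ] [DecidableEq ν] in
lemma integrable_trace_regInv_pow (hSm : ∀ a j, Measurable fun ω => S ω a j) {ε : ℝ} (hε : 0 < ε)
    (k : ℕ) : Integrable (fun ω => (regInv ε (S ω * U)).trace ^ k) P := by
  refine Integrable.of_bound ((measurable_trace_regInv hSm ε).pow_const k).aestronglyMeasurable
    ((Fintype.card ι * ε⁻¹) ^ k) (Eventually.of_forall fun ω => ?_)
  rw [norm_pow, Real.norm_of_nonneg (trace_regInv_nonneg hε.le _)]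
  refine pow_le_pow_left₀ (trace_regInv_nonneg hε.le _) ?_ k
  rw [← div_eq_mul_inv, le_div_iff₀ hε, mul_comm]
  exact mul_trace_regInv_le hε _

variable (hv : v ≠ 0) (hSm : ∀ a j, Measurable fun ω => S ω a j)
  (hS : ∀ a j, HasLaw (fun ω => S ω a j) (gaussianReal 0 v) P)
  (hind : iIndepFun (fun (c : ρ × ν) ω => S ω c.1 c.2) P) (hU : Uᵀ * U = 1)
  (hx : (3 : ℝ) < Fintype.card ρ - Fintype.card ι)
include hv hSm hS hind hU hx

/-- Uniform bound on the second moment of `tr (Gᵀ G + ε)⁻¹`. -/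
lemma exists_integral_trace_regInv_sq_le :
    ∃ C : ℝ, ∀ ε : ℝ, 0 < ε → ∫ ω, (regInv ε (S ω * U)).trace ^ 2 ∂P ≤ C := by
  set x : ℝ := Fintype.card ρ - Fintype.card ι with hxdef
  have hv0 : (0 : ℝ) < v := by positivity
  have hd : (0 : ℝ) ≤ Fintype.card ι := by positivity
  refine ⟨((x - 2) * Fintype.card ι + 2) * (Fintype.card ι / (v * (x - 1))) / (v * (x * (x - 3))),
    fun ε hε => ?_⟩
  have t1 : ∀ {F : Ω → Matrix ι ι ℝ}, (∀ i j, Integrable (fun ω => F ω i j) P ∧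
      ∫ ω, F ω i j ∂P = 0) → Integrable (fun ω => (F ω).trace) P ∧ ∫ ω, (F ω).trace ∂P = 0 := by
    intro F hF
    refine ⟨integrable_finsetSum _ fun i _ => (hF i i).1, ?_⟩
    rw [show (fun ω => (F ω).trace) = fun ω => ∑ i, F ω i i from rfl,
      integral_finsetSum _ fun i _ => (hF i i).1]
    exact Finset.sum_eq_zero fun i _ => (hF i i).2
  obtain ⟨i1, z1⟩ := t1 (integral_steinFirst_eq_zero hv hSm hS hind hU hε)
  obtain ⟨i2, z2⟩ := t1 (integral_steinSecond_eq_zero hv hSm hS hind hU hε)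
  obtain ⟨i3, z3⟩ := t1 (integral_steinThird_eq_zero hv hSm hS hind hU hε)
  rw [← hxdef] at i1 z1 i2 z2 i3 z3
  have iτ : Integrable (fun ω => (regInv ε (S ω * U)).trace) P := by
    simpa using integrable_trace_regInv_pow (P := P) (U := U) hSm hε 1
  have iτ2 := integrable_trace_regInv_pow (P := P) (U := U) hSm hε 2
  have b1 : v * (x - 1) * ∫ ω, (regInv ε (S ω * U)).trace ∂P ≤ Fintype.card ι := by
    have h := integral_mono (i1.add (iτ.const_mul (v * (x - 1))))
      (integrable_const (Fintype.card ι : ℝ))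
      (fun ω => trace_steinFirst_le (x := x) hε hv0.le (S ω * U))
    rw [Pi.add_def, integral_add i1 (iτ.const_mul _), z1, zero_add, integral_const_mul] at h
    simpa using h
  have b2 : v * (x * (x - 3)) * ∫ ω, (regInv ε (S ω * U)).trace ^ 2 ∂P
      ≤ ((x - 2) * Fintype.card ι + 2) * ∫ ω, (regInv ε (S ω * U)).trace ∂P := by
    have h := integral_mono (((i3.const_mul (x - 2)).add (i2.const_mul 2)).add
      (iτ2.const_mul (v * (x * (x - 3))))) (iτ.const_mul ((x - 2) * Fintype.card ι + 2))
      (fun ω => trace_steinThird_add_steinSecond_le (x := x) hε hv0.le (by linarith) (S ω * U))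
    rw [integral_const_mul] at h
    refine le_trans (le_of_eq ?_) h
    rw [integral_add' ((i3.const_mul _).add (i2.const_mul _)) (iτ2.const_mul _),
      integral_add' (i3.const_mul _) (i2.const_mul _)]
    simp only [integral_const_mul, z2, z3]
    ring
  have p1 : 0 < v * (x - 1) := mul_pos hv0 (by linarith)
  have p2 : 0 < v * (x * (x - 3)) := mul_pos hv0 (mul_pos (by linarith) (by linarith))
  rw [le_div_iff₀ p2, mul_comm]
  refine b2.trans (mul_le_mul_of_nonneg_left ?_ ?_)
  · rw [le_div_iff₀ p1, mul_comm]
    exact b1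
  · have := mul_nonneg (show 0 ≤ x - 2 by linarith) hd
    linarith

/-- By Fatou's lemma, the uniform second moment bound gives both the almost sure invertibility of
the Gram matrix and the square integrability of the trace of its inverse. -/
lemma ae_isUnit_det_gram_and_integrable_trace_sq :
    (∀ᵐ ω ∂P, IsUnit ((S ω * U)ᵀ * (S ω * U)).det) ∧
      Integrable (fun ω => (regInv 0 (S ω * U)).trace ^ 2) P := by
  obtain ⟨C, hC⟩ := exists_integral_trace_regInv_sq_le hv hSm hS hind hU hx
  let e : ℕ → ℝ := fun k => 1 / ((k : ℝ) + 1)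
  have he : ∀ k, 0 < e k := fun k => by positivity
  have het : Tendsto e atTop (nhds 0) := tendsto_one_div_add_atTop_nhds_zero_nat
  have het' : Tendsto e atTop (nhdsWithin 0 (Set.Ioi 0)) :=
    tendsto_nhdsWithin_iff.2 ⟨het, Eventually.of_forall he⟩
  let F : ℕ → Ω → ENNReal := fun k ω => ENNReal.ofReal ((regInv (e k) (S ω * U)).trace ^ 2)
  have hFm : ∀ k, Measurable (F k) := fun k =>
    ((measurable_trace_regInv hSm (e k)).pow_const 2).ennreal_ofReal
  have hlim : ∫⁻ ω, liminf (fun k => F k ω) atTop ∂P ≤ ENNReal.ofReal C := by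
    refine (lintegral_liminf_le hFm).trans ?_
    refine liminf_le_of_le (by isBoundedDefault) fun b hb => ?_
    obtain ⟨k, hk⟩ := hb.exists
    refine hk.trans ?_
    rw [← ofReal_integral_eq_lintegral_ofReal (integrable_trace_regInv_pow hSm (he k) 2)
      (Eventually.of_forall fun ω => sq_nonneg _)]
    exact ENNReal.ofReal_le_ofReal (hC _ (he k))
  have hmeas : Measurable fun ω => liminf (fun k => F k ω) atTop := Measurable.liminf hFm
  have hfin := ae_lt_top hmeas (hlim.trans_lt ENNReal.ofReal_lt_top).ne
  have hunit : ∀ᵐ ω ∂P, IsUnit ((S ω * U)ᵀ * (S ω * U)).det := by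
    filter_upwards [hfin] with ω hω
    by_contra hsing
    have h1 := (tendsto_trace_regInv_atTop hsing).comp het'
    have h2 : Tendsto (fun k => F k ω) atTop (nhds ⊤) :=
      ENNReal.tendsto_ofReal_atTop.comp ((tendsto_pow_atTop two_ne_zero).comp h1)
    rw [h2.liminf_eq] at hω
    exact lt_irrefl _ hω
  refine ⟨hunit, ((measurable_trace_regInv hSm 0).pow_const 2).aestronglyMeasurable, ?_⟩
  rw [hasFiniteIntegral_iff_ofReal (Eventually.of_forall fun ω => sq_nonneg _)]
  refine lt_of_le_of_lt (le_trans (lintegral_mono_ae ?_) hlim) ENNReal.ofReal_lt_top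
  filter_upwards [hunit] with ω hω
  have h1 : Tendsto (fun k => (regInv (e k) (S ω * U)).trace) atTop
      (nhds (regInv 0 (S ω * U)).trace) :=
    (continuous_id.matrix_trace.tendsto _).comp ((tendsto_regInv hω).comp het)
  have h2 : Tendsto (fun k => F k ω) atTop
      (nhds (ENNReal.ofReal ((regInv 0 (S ω * U)).trace ^ 2))) :=
    (ENNReal.continuous_ofReal.tendsto _).comp (h1.pow 2)
  exact h2.liminf_eq.ge

/-- The identities obtained from Stein's identity persist in the limit `ε → 0`. -/
lemma integral_stein_zero_eq_zero (i j : ι) :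
    (Integrable (fun ω => steinFirst v (Fintype.card ρ - Fintype.card ι) 0
      (regInv 0 (S ω * U)) i j) P ∧
    ∫ ω, steinFirst v (Fintype.card ρ - Fintype.card ι) 0 (regInv 0 (S ω * U)) i j ∂P = 0) ∧
    (Integrable (fun ω => steinSecond v (Fintype.card ρ - Fintype.card ι) 0
      (regInv 0 (S ω * U)) i j) P ∧
    ∫ ω, steinSecond v (Fintype.card ρ - Fintype.card ι) 0 (regInv 0 (S ω * U)) i j ∂P = 0) ∧
    (Integrable (fun ω => steinThird v (Fintype.card ρ - Fintype.card ι) 0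
      (regInv 0 (S ω * U)) i j) P ∧
    ∫ ω, steinThird v (Fintype.card ρ - Fintype.card ι) 0 (regInv 0 (S ω * U)) i j ∂P = 0) := by
  obtain ⟨hunit, hint⟩ := ae_isUnit_det_gram_and_integrable_trace_sq hv hSm hS hind hU hx
  set x : ℝ := Fintype.card ρ - Fintype.card ι with hxdef
  obtain ⟨C, hC⟩ := exists_abs_stein_le (ρ := ρ) v x i j
  let e : ℕ → ℝ := fun k => 1 / ((k : ℝ) + 1)
  have he : ∀ k, 0 < e k := fun k => by positivity
  have he1 : ∀ k, e k ≤ 1 := fun k => by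
    rw [div_le_one (by positivity)]
    exact le_add_of_nonneg_left (Nat.cast_nonneg k)
  have het : Tendsto e atTop (nhds 0) := tendsto_one_div_add_atTop_nhds_zero_nat
  have hD : Integrable (fun ω => C * (1 + (regInv 0 (S ω * U)).trace ^ 2)) P :=
    ((integrable_const 1).add hint).const_mul C
  have key : ∀ R : ℝ → Matrix ι ι ℝ → ℝ,
      (Continuous fun p : ℝ × Matrix ι ι ℝ => R p.1 p.2) →
      (∀ ε : ℝ, 0 < ε → ε ≤ 1 → ∀ G : Matrix ρ ι ℝ, IsUnit (Gᵀ * G).det →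
        |R ε (regInv ε G)| ≤ C * (1 + (regInv 0 G).trace ^ 2)) →
      (∀ ε : ℝ, 0 < ε → Integrable (fun ω => R ε (regInv ε (S ω * U))) P ∧
        ∫ ω, R ε (regInv ε (S ω * U)) ∂P = 0) →
      Integrable (fun ω => R 0 (regInv 0 (S ω * U))) P ∧
        ∫ ω, R 0 (regInv 0 (S ω * U)) ∂P = 0 := by
    intro R hR hb hz
    have hbd : ∀ k, ∀ᵐ ω ∂P, ‖R (e k) (regInv (e k) (S ω * U))‖
        ≤ C * (1 + (regInv 0 (S ω * U)).trace ^ 2) := fun k => by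
      filter_upwards [hunit] with ω hω using hb _ (he k) (he1 k) _ hω
    have hlim : ∀ᵐ ω ∂P, Tendsto (fun k => R (e k) (regInv (e k) (S ω * U))) atTop
        (nhds (R 0 (regInv 0 (S ω * U)))) := by
      filter_upwards [hunit] with ω hω
      exact (hR.tendsto (0, regInv 0 (S ω * U))).comp
        (het.prodMk_nhds ((tendsto_regInv hω).comp het))
    have hm := fun k => (hz (e k) (he k)).1.aestronglyMeasurable
    constructor
    · refine hD.mono' (aestronglyMeasurable_of_tendsto_ae atTop hm hlim) ?_
      filter_upwards [hlim, ae_all_iff.2 hbd] with ω h1 h2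
      exact le_of_tendsto h1.norm (Eventually.of_forall h2)
    · have h := tendsto_integral_of_dominated_convergence _ hm hD hbd hlim
      simp only [fun k => (hz (e k) (he k)).2] at h
      exact tendsto_nhds_unique h tendsto_const_nhds |>.symm ▸ rfl
  refine ⟨key (fun ε M => steinFirst v x ε M i j) ?_ (fun ε h1 h2 G hG => (hC ε h1 h2 G hG).1)
      (fun ε hε => integral_steinFirst_eq_zero hv hSm hS hind hU hε i j),
    key (fun ε M => steinSecond v x ε M i j) ?_ (fun ε h1 h2 G hG => (hC ε h1 h2 G hG).2.1)
      (fun ε hε => integral_steinSecond_eq_zero hv hSm hS hind hU hε i j),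
    key (fun ε M => steinThird v x ε M i j) ?_ (fun ε h1 h2 G hG => (hC ε h1 h2 G hG).2.2)
      (fun ε hε => integral_steinThird_eq_zero hv hSm hS hind hU hε i j)⟩
  all_goals
    refine Continuous.matrix_elem ?_ i j
    first | unfold steinFirst | unfold steinSecond | unfold steinThird
    have htr : Continuous fun p : ℝ × Matrix ι ι ℝ => p.2.trace := continuous_snd.matrix_trace
    have htr2 : Continuous fun p : ℝ × Matrix ι ι ℝ => (p.2 * p.2).trace :=
      (continuous_snd.matrix_mul continuous_snd).matrix_trace
    fun_prop

/-- First and second moments of the inverse Gram matrix of an `m × d` Gaussian matrix `G = S * U`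
with entries of variance `v`, where `x = m - d > 3`. -/
theorem inverse_gram_moments :
    (∀ i j, Integrable (fun ω => regInv 0 (S ω * U) i j) P) ∧
    (∀ i j k l, Integrable (fun ω => regInv 0 (S ω * U) i j * regInv 0 (S ω * U) k l) P) ∧
    (∀ i j, ∫ ω, regInv 0 (S ω * U) i j ∂P =
      1 / (v * (Fintype.card ρ - Fintype.card ι - 1)) * (1 : Matrix ι ι ℝ) i j) ∧
    (∀ i j, ∫ ω, (regInv 0 (S ω * U) * regInv 0 (S ω * U)) i j ∂P =
      (Fintype.card ρ - 1) / (v ^ 2 * (Fintype.card ρ - Fintype.card ι)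
        * (Fintype.card ρ - Fintype.card ι - 1) * (Fintype.card ρ - Fintype.card ι - 3))
        * (1 : Matrix ι ι ℝ) i j) := by
  obtain ⟨-, hint⟩ := ae_isUnit_det_gram_and_integrable_trace_sq hv hSm hS hind hU hx
  have hz := integral_stein_zero_eq_zero hv hSm hS hind hU hx
  have hv0 : (0 : ℝ) < v := by positivity
  have hm := fun i j => measurable_regInv_apply hSm U 0 i j
  have habs : ∀ ω i j, |regInv 0 (S ω * U) i j| ≤ (regInv 0 (S ω * U)).trace := fun ω =>
    abs_apply_le_trace (posSemidef_regInv le_rfl _)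
  have i1 : ∀ i j, Integrable (fun ω => regInv 0 (S ω * U) i j) P := fun i j =>
    ((integrable_const (1 : ℝ)).add hint).mono' (hm i j).aestronglyMeasurable
      (Eventually.of_forall fun ω => by
        have := habs ω i j
        simp only [Real.norm_eq_abs, Pi.add_apply]
        nlinarith [sq_nonneg ((regInv 0 (S ω * U)).trace - 1)])
  have i2 : ∀ i j k l, Integrable (fun ω => regInv 0 (S ω * U) i j * regInv 0 (S ω * U) k l) P :=
    fun i j k l => hint.mono' ((hm i j).mul (hm k l)).aestronglyMeasurable
      (Eventually.of_forall fun ω => by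
        rw [Real.norm_eq_abs, abs_mul, sq]
        exact mul_le_mul (habs ω i j) (habs ω k l) (abs_nonneg _)
          ((abs_nonneg _).trans (habs ω i j)))
  set d : ℝ := (Fintype.card ι : ℝ) with hd
  set m : ℝ := (Fintype.card ρ : ℝ) with hmm
  have m1 : ∀ i j, ∫ ω, regInv 0 (S ω * U) i j ∂P
      = 1 / (v * (m - d - 1)) * (1 : Matrix ι ι ℝ) i j := fun i j => by
    have h := (hz i j).1.2
    simp only [steinFirst, zero_smul, zero_mul, add_zero, sub_zero, Matrix.sub_apply,
      Matrix.smul_apply, smul_eq_mul] at h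
    rw [integral_sub (integrable_const _) (((i1 i j).const_mul _).const_mul _),
      integral_const_mul, integral_const_mul, integral_const] at h
    simp only [probReal_univ, one_smul] at h
    have : v * (m - d - 1) ≠ 0 := (mul_pos hv0 (by linarith)).ne'
    rw [one_div, eq_inv_mul_iff_mul_eq₀ this]
    linarith
  refine ⟨i1, i2, m1, fun i j => ?_⟩
  have iMM : Integrable (fun ω => (regInv 0 (S ω * U) * regInv 0 (S ω * U)) i j) P := by
    simp only [Matrix.mul_apply]
    exact integrable_finsetSum _ fun k _ => i2 i k k j
  have iτ : Integrable (fun ω => (regInv 0 (S ω * U)).trace) P :=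
    integrable_finsetSum _ fun k _ => i1 k k
  have mτ : ∫ ω, (regInv 0 (S ω * U)).trace ∂P = d * (1 / (v * (m - d - 1))) := by
    rw [show (fun ω => (regInv 0 (S ω * U)).trace) = fun ω => ∑ i, regInv 0 (S ω * U) i i from rfl,
      integral_finsetSum _ fun i _ => i1 i i]
    simp [m1, hd]
  obtain ⟨-, ⟨j2, z2⟩, j3, z3⟩ := hz i j
  -- this combination eliminates the mixed term `tr(W) W`
  have hcomb : ∀ ω, (m - d - 1) * steinSecond v (m - d) 0 (regInv 0 (S ω * U)) i j
      + steinThird v (m - d) 0 (regInv 0 (S ω * U)) i j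
      = (m - d - 1) * regInv 0 (S ω * U) i j
        + (regInv 0 (S ω * U)).trace * (1 : Matrix ι ι ℝ) i j
        - v * ((m - d) * (m - d - 3)) * (regInv 0 (S ω * U) * regInv 0 (S ω * U)) i j := fun ω => by
    simp only [steinSecond, steinThird, zero_smul, zero_mul, mul_zero, add_zero, sub_zero,
      Matrix.sub_apply, Matrix.smul_apply, smul_eq_mul]
    ring
  have iadd : Integrable (fun ω => (m - d - 1) * regInv 0 (S ω * U) i j
      + (regInv 0 (S ω * U)).trace * (1 : Matrix ι ι ℝ) i j) P :=
    ((i1 i j).const_mul _).add (iτ.mul_const _)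
  have h := integral_congr_ae (μ := P) (Eventually.of_forall hcomb)
  rw [integral_add (j2.const_mul _) j3, integral_const_mul, z2, z3,
    integral_sub iadd (iMM.const_mul _),
    integral_add ((i1 i j).const_mul _) (iτ.mul_const _), integral_const_mul, integral_mul_const,
    integral_const_mul, m1, mτ] at h
  have h1 : m - d - 1 ≠ 0 := ne_of_gt (by linarith)
  have h2 : m - d ≠ 0 := ne_of_gt (by linarith)
  have h3 : m - d - 3 ≠ 0 := ne_of_gt (by linarith)
  have hv1 : (v : ℝ) ≠ 0 := hv0.ne'
  have h4 : ∫ ω, (regInv 0 (S ω * U) * regInv 0 (S ω * U)) i j ∂P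
      = ((m - d - 1) * (1 / (v * (m - d - 1)) * (1 : Matrix ι ι ℝ) i j)
        + d * (1 / (v * (m - d - 1))) * (1 : Matrix ι ι ℝ) i j)
          / (v * ((m - d) * (m - d - 3))) := by
    rw [eq_div_iff (mul_ne_zero hv1 (mul_ne_zero h2 h3))]
    linarith
  rw [h4]
  field_simp
  ring

end InverseMoments

/-! ### Least squares, the workers' steps, and the error recursion -/

section LeastSquares

lemma sqNorm_eq_dotProduct {ι : Type*} [Fintype ι] (v : ι → ℝ) : sqNorm v = v ⬝ᵥ v := by
  rw [sqNorm, EuclideanSpace.real_norm_sq_eq]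
  exact Finset.sum_congr rfl fun i _ => sq _

variable {κ ι : Type*} [Fintype κ] [Fintype ι]

/-- Expansion of a least-squares objective around a point. -/
lemma sqNorm_add_smul (u w : ι → ℝ) (s : ℝ) :
    sqNorm (u + s • w) = sqNorm u + 2 * s * (u ⬝ᵥ w) + s ^ 2 * sqNorm w := by
  simp only [sqNorm_eq_dotProduct, add_dotProduct, dotProduct_add, smul_dotProduct,
    dotProduct_smul, smul_eq_mul, dotProduct_comm w u]
  ring

/-- The normal equations of the least-squares problem. -/
lemma transpose_mulVec_residual_eq_zero {A : Matrix κ ι ℝ} {b : κ → ℝ} {xs : ι → ℝ}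
    (h : IsMinOn (fun x => sqNorm (A *ᵥ x - b)) Set.univ xs) : Aᵀ *ᵥ (A *ᵥ xs - b) = 0 := by
  set r := A *ᵥ xs - b with hr
  set w := Aᵀ *ᵥ r with hw
  have hrw : r ⬝ᵥ (A *ᵥ w) = w ⬝ᵥ w := by
    rw [Matrix.dotProduct_mulVec, ← Matrix.mulVec_transpose]
  have key : ∀ s : ℝ, 0 ≤ 2 * s * (w ⬝ᵥ w) + s ^ 2 * sqNorm (A *ᵥ w) := fun s => by
    have h1 := isMinOn_iff.1 h (xs + s • w) (Set.mem_univ _)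
    have h2 : A *ᵥ (xs + s • w) - b = r + s • (A *ᵥ w) := by
      rw [Matrix.mulVec_add, Matrix.mulVec_smul, hr]
      abel
    rw [h2, sqNorm_add_smul, hrw] at h1
    linarith
  have hww : 0 ≤ w ⬝ᵥ w := by
    rw [← sqNorm_eq_dotProduct]; exact sq_nonneg _
  have hAw : 0 ≤ sqNorm (A *ᵥ w) := sq_nonneg _
  refine dotProduct_self_eq_zero.1 (le_antisymm ?_ hww)
  -- a small step against the gradient would decrease the objective
  have h1 := key (-((w ⬝ᵥ w) * (sqNorm (A *ᵥ w) + 1)⁻¹))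
  have hp : 0 < sqNorm (A *ᵥ w) + 1 := by positivity
  generalize sqNorm (A *ᵥ w) = a at *
  generalize w ⬝ᵥ w = c at *
  have h2 : (a + 1)⁻¹ * a ≤ 1 := by
    rw [inv_mul_le_iff₀ hp]
    linarith
  have hr : 0 < (a + 1)⁻¹ := inv_pos.2 hp
  generalize (a + 1)⁻¹ = r at *
  by_contra hc
  have h3 : 0 < r * c ^ 2 := mul_pos hr (pow_pos (not_le.1 hc) 2)
  nlinarith

variable [DecidableEq ι]

/-- A nondegenerate convex quadratic has a unique minimizer, so `argmin` does not depend on any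
choice. -/
lemma argmin_quadratic (B : Matrix κ ι ℝ) (hB : IsUnit (Bᵀ * B).det) (g : ι → ℝ) :
    (argmin fun Δ => (1 / 2 : ℝ) * sqNorm (B *ᵥ Δ) + g ⬝ᵥ Δ) = -((Bᵀ * B)⁻¹ *ᵥ g) := by
  set Δ₀ := -((Bᵀ * B)⁻¹ *ᵥ g) with hΔ₀
  set f := fun Δ => (1 / 2 : ℝ) * sqNorm (B *ᵥ Δ) + g ⬝ᵥ Δ with hf
  have hg : (Bᵀ * B) *ᵥ Δ₀ = -g := by
    rw [hΔ₀, Matrix.mulVec_neg, Matrix.mulVec_mulVec, Matrix.mul_nonsing_inv _ hB,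
      Matrix.one_mulVec]
  have hexp : ∀ Δ, f Δ = f Δ₀ + 1 / 2 * sqNorm (B *ᵥ (Δ - Δ₀)) := fun Δ => by
    have h1 : B *ᵥ Δ = B *ᵥ Δ₀ + (1 : ℝ) • (B *ᵥ (Δ - Δ₀)) := by
      rw [one_smul, ← Matrix.mulVec_add]
      congr 1
      abel
    have h2 : (B *ᵥ Δ₀) ⬝ᵥ (B *ᵥ (Δ - Δ₀)) = -(g ⬝ᵥ (Δ - Δ₀)) := by
      rw [Matrix.dotProduct_mulVec, ← Matrix.mulVec_transpose, Matrix.mulVec_mulVec, hg,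
        neg_dotProduct]
    simp only [hf]
    rw [h1, sqNorm_add_smul, h2, dotProduct_sub]
    ring
  have hmin : IsMinOn f Set.univ Δ₀ := isMinOn_iff.2 fun Δ _ => by
    rw [hexp Δ]
    have : 0 ≤ sqNorm (B *ᵥ (Δ - Δ₀)) := sq_nonneg _
    linarith
  have hex : ∃ x, IsMinOn f Set.univ x := ⟨Δ₀, hmin⟩
  rw [argmin, dif_pos hex]
  have h1 := isMinOn_iff.1 hex.choose_spec Δ₀ (Set.mem_univ _)
  rw [hexp hex.choose, sqNorm_eq_dotProduct] at h1
  have h2 : B *ᵥ (hex.choose - Δ₀) = 0 := by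
    refine dotProduct_self_eq_zero.1 (le_antisymm (by linarith) ?_)
    rw [← sqNorm_eq_dotProduct]
    exact sq_nonneg _
  have h3 : (Bᵀ * B)⁻¹ *ᵥ ((Bᵀ * B) *ᵥ (hex.choose - Δ₀)) = 0 := by
    rw [← Matrix.mulVec_mulVec, h2, Matrix.mulVec_zero, Matrix.mulVec_zero]
  rw [Matrix.mulVec_mulVec, Matrix.nonsing_inv_mul _ hB, Matrix.one_mulVec, sub_eq_zero] at h3
  exact h3

open scoped MatrixOrder in
/-- A matrix of full column rank factors as a matrix with orthonormal columns times an invertible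
square matrix. -/
lemma exists_orthonormal_mul_isUnit {A : Matrix κ ι ℝ} (hA : A.rank = Fintype.card ι) :
    ∃ (U : Matrix κ ι ℝ) (T : Matrix ι ι ℝ), Uᵀ * U = 1 ∧ IsUnit T.det ∧ A = U * T := by
  have hps : (Aᵀ * A).PosSemidef := by simpa using posSemidef_conjTranspose_mul_self A
  obtain ⟨T, hT⟩ := CStarAlgebra.nonneg_iff_eq_star_mul_self.mp hps.nonneg
  have hT' : Aᵀ * A = Tᵀ * T := by simpa [Matrix.star_eq_conjTranspose] using hT
  have hTu : IsUnit T.det := by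
    have h1 : T.rank = Fintype.card ι := by
      rw [← rank_transpose_mul_self T, ← hT', rank_transpose_mul_self, hA]
    rw [← Matrix.isUnit_iff_isUnit_det, ← Matrix.mulVec_surjective_iff_isUnit]
    refine (LinearMap.range_eq_top (f := T.mulVecLin)).1 (Submodule.eq_top_of_finrank_eq ?_)
    rw [Module.finrank_fintype_fun_eq_card, ← h1]
    rfl
  refine ⟨A * T⁻¹, T, ?_, hTu, ?_⟩
  · rw [Matrix.transpose_mul, Matrix.mul_assoc, ← Matrix.mul_assoc Aᵀ, hT', Matrix.mul_assoc,
      Matrix.mul_nonsing_inv _ hTu, Matrix.mul_one, ← Matrix.transpose_mul,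
      Matrix.mul_nonsing_inv _ hTu, Matrix.transpose_one]
  · rw [Matrix.mul_assoc, Matrix.nonsing_inv_mul _ hTu, Matrix.mul_one]

end LeastSquares

section Recursion

/-- The recursion satisfied by the error in orthonormal coordinates on the range of `A`:
`v (t + 1) = v t - c ∑ k, W t k v t`. -/
def errCoord {q : ℕ} {ι : Type*} [Fintype ι] (c : ℝ) (W : ℕ → Fin q → Matrix ι ι ℝ)
    (v₀ : ι → ℝ) : ℕ → ι → ℝ
  | 0 => v₀
  | t + 1 => errCoord c W v₀ t - c • ∑ k, W t k *ᵥ errCoord c W v₀ t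

variable {q m n d : ℕ}

/-- For an invertible sketched Gram matrix, a worker's step in orthonormal coordinates is
`-(Gᵀ G)⁻¹ v` with `G = S U`. -/
lemma mulVec_workerDirection {U : Matrix (Fin n) (Fin d) ℝ} (hU : Uᵀ * U = 1)
    {T : Matrix (Fin d) (Fin d) ℝ} (hT : IsUnit T.det) {S : Matrix (Fin m) (Fin n) ℝ}
    (hS : IsUnit ((S * U)ᵀ * (S * U)).det) (v : Fin d → ℝ) :
    T *ᵥ workerDirection (U * T) S ((U * T)ᵀ *ᵥ (U *ᵥ v)) = -(regInv 0 (S * U) *ᵥ v) := by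
  have hgram : (S * (U * T))ᵀ * (S * (U * T)) = Tᵀ * ((S * U)ᵀ * (S * U)) * T := by
    rw [← Matrix.mul_assoc S, Matrix.transpose_mul (S * U)]
    simp only [Matrix.mul_assoc]
  have hunit : IsUnit ((S * (U * T))ᵀ * (S * (U * T))).det := by
    rw [hgram, Matrix.det_mul, Matrix.det_mul, Matrix.det_transpose]
    exact (hT.mul hS).mul hT
  have hg : (U * T)ᵀ *ᵥ (U *ᵥ v) = Tᵀ *ᵥ v := by
    rw [Matrix.mulVec_mulVec, Matrix.transpose_mul, Matrix.mul_assoc, hU, Matrix.mul_one]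
  have hT' : IsUnit Tᵀ.det := by rwa [Matrix.det_transpose]
  rw [workerDirection, argmin_quadratic _ hunit, hg, hgram, Matrix.mul_inv_rev, Matrix.mul_inv_rev,
    Matrix.mulVec_neg, Matrix.mulVec_mulVec, Matrix.mulVec_mulVec, regInv, zero_smul, add_zero]
  congr 2
  rw [← Matrix.mul_assoc, Matrix.mul_nonsing_inv _ hT, Matrix.one_mul, Matrix.mul_assoc,
    Matrix.nonsing_inv_mul _ hT', Matrix.mul_one]

/-- The error of the iterates in orthonormal coordinates, as long as all sketched Gram matrices are
invertible. -/
lemma mulVec_iterate_sub {U : Matrix (Fin n) (Fin d) ℝ} (hU : Uᵀ * U = 1)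
    {T : Matrix (Fin d) (Fin d) ℝ} (hT : IsUnit T.det) {b : Fin n → ℝ} {xs : Fin d → ℝ}
    (hxs : (U * T)ᵀ *ᵥ ((U * T) *ᵥ xs - b) = 0) (μ : ℝ) (x₀ : Fin d → ℝ)
    {S : ℕ → Fin q → Matrix (Fin m) (Fin n) ℝ}
    (hS : ∀ t k, IsUnit ((S t k * U)ᵀ * (S t k * U)).det) (t : ℕ) :
    T *ᵥ (iterate (U * T) b μ x₀ S t - xs) =
      errCoord (μ * (1 / (q : ℝ))) (fun t k => regInv 0 (S t k * U)) (T *ᵥ (x₀ - xs)) t := by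
  induction t with
  | zero => rfl
  | succ t ih =>
    rw [errCoord, ← ih, iterate]
    set y := iterate (U * T) b μ x₀ S t with hy
    have hg : (U * T)ᵀ *ᵥ ((U * T) *ᵥ y - b) = (U * T)ᵀ *ᵥ (U *ᵥ (T *ᵥ (y - xs))) := by
      rw [Matrix.mulVec_mulVec (y - xs), Matrix.mulVec_sub (U * T) y xs,
        show (U * T) *ᵥ y - b = ((U * T) *ᵥ y - (U * T) *ᵥ xs) + ((U * T) *ᵥ xs - b) by abel,
        Matrix.mulVec_add, hxs, add_zero]
    have hw : ∀ k, T *ᵥ workerDirection (U * T) (S t k) ((U * T)ᵀ *ᵥ ((U * T) *ᵥ y - b))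
        = -(regInv 0 (S t k * U) *ᵥ (T *ᵥ (y - xs))) := fun k => by
      rw [hg, mulVec_workerDirection hU hT (hS t k)]
    rw [add_sub_right_comm, Matrix.mulVec_add, Matrix.mulVec_smul, Matrix.mulVec_sum,
      Finset.sum_congr rfl fun k _ => hw k, Finset.sum_neg_distrib, smul_neg, ← sub_eq_add_neg]

lemma sqNorm_errorVec {U : Matrix (Fin n) (Fin d) ℝ} (hU : Uᵀ * U = 1)
    (T : Matrix (Fin d) (Fin d) ℝ) (xs y : Fin d → ℝ) :
    sqNorm (errorVec (U * T) xs y) = (T *ᵥ (y - xs)) ⬝ᵥ (T *ᵥ (y - xs)) := by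
  rw [sqNorm_eq_dotProduct, errorVec, ← Matrix.mulVec_mulVec, Matrix.dotProduct_mulVec,
    ← Matrix.mulVec_transpose, Matrix.mulVec_mulVec, hU, Matrix.one_mulVec]

end Recursion

/-! ### Conditional mean of one step -/

section OneStep

variable {Ω ι : Type*} [Fintype ι] [DecidableEq ι]

/-- Conditional expectation of a random quadratic form `yᵀ B y`, where `y` is known given `m₁`, and
`B` is independent of `m₁` with mean `γ` times the identity. -/
lemma condExp_quadraticForm {m₁ m₂ mΩ : MeasurableSpace Ω} {P : Measure Ω}
    [IsProbabilityMeasure P] (h₁ : m₁ ≤ mΩ) (h₂ : m₂ ≤ mΩ) (hind : Indep m₂ m₁ P)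
    {y : Ω → ι → ℝ} (hy : ∀ i, Measurable[m₁] fun ω => y ω i)
    (hyi : Integrable (fun ω => y ω ⬝ᵥ y ω) P)
    {B : Ω → Matrix ι ι ℝ} (hB : ∀ i j, Measurable[m₂] fun ω => B ω i j)
    (hBi : ∀ i j, Integrable (fun ω => B ω i j) P) {γ : ℝ}
    (hBm : ∀ i j, ∫ ω, B ω i j ∂P = γ * (1 : Matrix ι ι ℝ) i j) :
    Integrable (fun ω => y ω ⬝ᵥ (B ω *ᵥ y ω)) P ∧
    P[fun ω => y ω ⬝ᵥ (B ω *ᵥ y ω) | m₁] =ᵐ[P] fun ω => γ * (y ω ⬝ᵥ y ω) := by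
  have hyij : ∀ i j, Measurable[m₁] fun ω => y ω i * y ω j := fun i j => (hy i).mul (hy j)
  have hyij_int : ∀ i j, Integrable (fun ω => y ω i * y ω j) P := fun i j => by
    refine hyi.mono' ((hyij i j).mono h₁ le_rfl).aestronglyMeasurable
      (Filter.Eventually.of_forall fun ω => ?_)
    have h : ∀ i, y ω i * y ω i ≤ y ω ⬝ᵥ y ω := fun i =>
      Finset.single_le_sum (f := fun i => y ω i * y ω i) (fun i _ => mul_self_nonneg _)
        (Finset.mem_univ i)
    rw [Real.norm_eq_abs, abs_le]
    constructor
    · nlinarith [h i, h j, sq_nonneg (y ω i + y ω j)]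
    · nlinarith [h i, h j, sq_nonneg (y ω i - y ω j)]
  have hindf : ∀ i j, IndepFun (fun ω => y ω i * y ω j) (fun ω => B ω i j) P := fun i j =>
    (IndepFun_iff_Indep _ _ _).2 (indep_of_indep_of_le hind.symm (hyij i j).comap_le
      (hB i j).comap_le)
  have hprod : ∀ i j, Integrable ((fun ω => y ω i * y ω j) * fun ω => B ω i j) P := fun i j =>
    (hindf i j).integrable_mul (hyij_int i j) (hBi i j)
  have hexp : (fun ω => y ω ⬝ᵥ (B ω *ᵥ y ω))
      = ∑ i, ∑ j, (fun ω => y ω i * y ω j) * fun ω => B ω i j := by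
    funext ω
    simp only [dotProduct, Matrix.mulVec, Finset.mul_sum, Finset.sum_apply, Pi.mul_apply]
    exact Finset.sum_congr rfl fun i _ => Finset.sum_congr rfl fun j _ => by ring
  have hcond : ∀ i j, P[(fun ω => y ω i * y ω j) * fun ω => B ω i j | m₁]
      =ᵐ[P] fun ω => y ω i * y ω j * (γ * (1 : Matrix ι ι ℝ) i j) := fun i j => by
    have e1 := condExp_mul_of_stronglyMeasurable_left (hyij i j).stronglyMeasurable (hprod i j)
      (hBi i j)
    have e2 := condExp_indep_eq h₂ h₁ (hB i j).stronglyMeasurable hind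
    filter_upwards [e1, e2] with ω hω1 hω2
    rw [hω1, Pi.mul_apply, hω2, hBm]
  have hrow : ∀ i, Integrable (∑ j, (fun ω => y ω i * y ω j) * fun ω => B ω i j) P := fun i =>
    integrable_finsetSum' _ fun j _ => hprod i j
  rw [hexp]
  refine ⟨integrable_finsetSum' _ fun i _ => hrow i, ?_⟩
  refine (condExp_finsetSum (fun i _ => hrow i) m₁).trans ?_
  have hall : ∀ᵐ ω ∂P, ∀ i,
      (P[∑ j, (fun ω => y ω i * y ω j) * fun ω => B ω i j | m₁]) ω
        = ∑ j, y ω i * y ω j * (γ * (1 : Matrix ι ι ℝ) i j) := by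
    refine ae_all_iff.2 fun i => ?_
    have e := condExp_finsetSum (μ := P) (s := Finset.univ) (fun j _ => hprod i j) m₁
    filter_upwards [e, ae_all_iff.2 fun j => hcond i j] with ω h1 h2
    rw [h1, Finset.sum_apply]
    exact Finset.sum_congr rfl fun j _ => h2 j
  filter_upwards [hall] with ω hω
  rw [Finset.sum_apply, Finset.sum_congr rfl fun i _ => hω i, dotProduct, Finset.mul_sum]
  refine Finset.sum_congr rfl fun i _ => ?_
  simp [Matrix.one_apply]
  ring

/-- Mean of the square of `1 - c ∑ k, W k` for independent matrices `W k` whose means are `α`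
and whose squares have mean `β` times the identity. -/
lemma integral_sq_one_sub_sum {mΩ : MeasurableSpace Ω} {P : Measure Ω} [IsProbabilityMeasure P]
    {q : ℕ} {W : Fin q → Ω → Matrix ι ι ℝ}
    (hW : ∀ k i j, Integrable (fun ω => W k ω i j) P)
    (hWW : ∀ k i j r s, Integrable (fun ω => W k ω i j * W k ω r s) P)
    (hind : ∀ k l, k ≠ l → ∀ i j r s, IndepFun (fun ω => W k ω i j) (fun ω => W l ω r s) P)
    {α β : ℝ} (hα : ∀ k i j, ∫ ω, W k ω i j ∂P = α * (1 : Matrix ι ι ℝ) i j)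
    (hβ : ∀ k i j, ∫ ω, (W k ω * W k ω) i j ∂P = β * (1 : Matrix ι ι ℝ) i j) (c : ℝ) (i j : ι) :
    Integrable (fun ω => ((1 - c • ∑ k, W k ω) * (1 - c • ∑ k, W k ω)) i j) P ∧
    ∫ ω, ((1 - c • ∑ k, W k ω) * (1 - c • ∑ k, W k ω)) i j ∂P
      = (1 - 2 * c * q * α + c ^ 2 * (q * β + q * (q - 1) * α ^ 2)) * (1 : Matrix ι ι ℝ) i j := by
  have hkl : ∀ k l i j r s, Integrable (fun ω => W k ω i j * W l ω r s) P := fun k l i j r s => by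
    by_cases h : k = l
    · subst h; exact hWW k i j r s
    · exact (hind k l h i j r s).integrable_mul (hW k i j) (hW l r s)
  have hmul : ∀ k l, Integrable (fun ω => (W k ω * W l ω) i j) P := fun k l => by
    simp only [Matrix.mul_apply]
    exact integrable_finsetSum _ fun r _ => hkl k l i r r j
  have hval : ∀ k l, ∫ ω, (W k ω * W l ω) i j ∂P
      = (if k = l then β else α ^ 2) * (1 : Matrix ι ι ℝ) i j := fun k l => by
    by_cases h : k = l
    · subst h; simp [hβ]
    · simp only [Matrix.mul_apply, h, if_false]
      rw [integral_finsetSum _ fun r _ => hkl k l i r r j]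
      have : ∀ r, ∫ ω, W k ω i r * W l ω r j ∂P
          = α ^ 2 * ((1 : Matrix ι ι ℝ) i r * (1 : Matrix ι ι ℝ) r j) := fun r => by
        rw [(hind k l h i r r j).integral_fun_mul_eq_mul_integral (hW k i r).aestronglyMeasurable
          (hW l r j).aestronglyMeasurable, hα, hα]
        ring
      rw [Finset.sum_congr rfl fun r _ => this r, ← Finset.mul_sum, ← Matrix.mul_apply,
        Matrix.mul_one]
  have hexp : ∀ ω, ((1 - c • ∑ k, W k ω) * (1 - c • ∑ k, W k ω)) i j
      = (1 : Matrix ι ι ℝ) i j - 2 * c * ∑ k, W k ω i j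
        + c ^ 2 * ∑ k, ∑ l, (W k ω * W l ω) i j := fun ω => by
    have : (1 - c • ∑ k, W k ω) * (1 - c • ∑ k, W k ω)
        = 1 - (2 * c) • ∑ k, W k ω + (c ^ 2) • ∑ k, ∑ l, W k ω * W l ω := by
      rw [← Finset.sum_mul_sum, Matrix.sub_mul, Matrix.mul_sub, Matrix.mul_sub, Matrix.one_mul,
        Matrix.mul_one, Matrix.one_mul, Matrix.smul_mul, Matrix.mul_smul]
      module
    rw [this]
    simp [Matrix.sum_apply]
  have i1 : Integrable (fun ω => ∑ k, W k ω i j) P := integrable_finsetSum _ fun k _ => hW k i j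
  have i2 : Integrable (fun ω => ∑ k, ∑ l, (W k ω * W l ω) i j) P :=
    integrable_finsetSum _ fun k _ => integrable_finsetSum _ fun l _ => hmul k l
  have i3 : Integrable (fun ω => (1 : Matrix ι ι ℝ) i j - 2 * c * ∑ k, W k ω i j) P :=
    (integrable_const _).sub (i1.const_mul _)
  simp only [hexp]
  refine ⟨i3.add (i2.const_mul _), ?_⟩
  rw [integral_add i3 (i2.const_mul _), integral_sub (integrable_const _) (i1.const_mul _),
    integral_const_mul, integral_const_mul, integral_finsetSum _ fun k _ => hW k i j,
    integral_finsetSum _ fun k _ => integrable_finsetSum _ fun l _ => hmul k l]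
  have hs : ∑ k : Fin q, ∫ ω, ∑ l, (W k ω * W l ω) i j ∂P
      = (q * β + q * (q - 1) * α ^ 2) * (1 : Matrix ι ι ℝ) i j := by
    have : ∀ k : Fin q, ∫ ω, ∑ l, (W k ω * W l ω) i j ∂P
        = (β + (q - 1) * α ^ 2) * (1 : Matrix ι ι ℝ) i j := fun k => by
      rw [integral_finsetSum _ fun l _ => hmul k l, Finset.sum_congr rfl fun l _ => hval k l,
        ← Finset.sum_mul, ← Finset.add_sum_erase _ _ (Finset.mem_univ k), if_pos rfl,
        Finset.sum_congr rfl fun l hl => if_neg (Finset.ne_of_mem_erase hl).symm,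
        Finset.sum_const, Finset.card_erase_of_mem (Finset.mem_univ k), Finset.card_univ,
        Fintype.card_fin, nsmul_eq_mul, Nat.cast_pred (Fin.pos k)]
    rw [Finset.sum_congr rfl fun k _ => this k, Finset.sum_const, Finset.card_univ,
      Fintype.card_fin, nsmul_eq_mul]
    ring
  rw [hs]
  simp only [hα, Finset.sum_const, Finset.card_univ, Fintype.card_fin, nsmul_eq_mul,
    integral_const, probReal_univ, one_smul]
  ring

end OneStep

/-! ### Independence of the sketches and the error decay -/

section Sketches

variable {Ω : Type*} {q m n d : ℕ}

/-- The σ-algebra generated by the entries, indexed by `(t, k, i, j)`, in the set `J`. -/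
@[reducible]
def entrySigma (S : ℕ → Fin q → Ω → Matrix (Fin m) (Fin n) ℝ)
    (J : Set (ℕ × Fin q × Fin m × Fin n)) : MeasurableSpace Ω :=
  ⨆ a ∈ J, MeasurableSpace.comap (fun ω => S a.1 a.2.1 ω a.2.2.1 a.2.2.2) inferInstance

variable {S : ℕ → Fin q → Ω → Matrix (Fin m) (Fin n) ℝ}

lemma measurable_entrySigma {J : Set (ℕ × Fin q × Fin m × Fin n)} {t : ℕ} {k : Fin q} {i : Fin m}
    {j : Fin n} (h : (t, k, i, j) ∈ J) : Measurable[entrySigma S J] fun ω => S t k ω i j :=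
  Measurable.of_comap_le (le_iSup₂_of_le (t, k, i, j) h le_rfl)

lemma measurable_history [MeasurableSpace Ω] {s t : ℕ} (h : s < t) (k : Fin q) (i : Fin m)
    (j : Fin n) : Measurable[history S t] fun ω => S s k ω i j :=
  Measurable.of_comap_le (le_iSup₂_of_le s h (le_iSup₂_of_le k i (le_iSup_of_le j le_rfl)))

lemma history_le_entrySigma [MeasurableSpace Ω] (t : ℕ) :
    history S t ≤ entrySigma S {a | a.1 < t} :=
  iSup₂_le fun s hs => iSup₂_le fun k i => iSup_le fun j =>
    (measurable_entrySigma (J := {a | a.1 < t}) (show (s, k, i, j) ∈ _ from hs)).comap_le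

variable [MeasurableSpace Ω] {P : Measure Ω}

namespace IsIIDGaussianSketch

lemma entrySigma_le (hS : IsIIDGaussianSketch P S) (J : Set (ℕ × Fin q × Fin m × Fin n)) :
    entrySigma S J ≤ ‹MeasurableSpace Ω› :=
  iSup₂_le fun _ _ => (hS.measurable_entry _ _ _ _).comap_le

lemma history_le (hS : IsIIDGaussianSketch P S) (t : ℕ) : history S t ≤ ‹MeasurableSpace Ω› :=
  (history_le_entrySigma t).trans (hS.entrySigma_le _)

lemma indep_entrySigma (hS : IsIIDGaussianSketch P S) {J K : Set (ℕ × Fin q × Fin m × Fin n)}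
    (h : Disjoint J K) : Indep (entrySigma S J) (entrySigma S K) P :=
  indep_iSup_of_disjoint (fun _ => (hS.measurable_entry _ _ _ _).comap_le) hS.indep.iIndep h

end IsIIDGaussianSketch

variable [IsProbabilityMeasure P]

/-- First and second moments of the inverse sketched Gram matrices. -/
lemma IsIIDGaussianSketch.moments (hS : IsIIDGaussianSketch P S) (hm : d + 3 < m)
    {U : Matrix (Fin n) (Fin d) ℝ} (hU : Uᵀ * U = 1) (t : ℕ) (k : Fin q) :
    (∀ᵐ ω ∂P, IsUnit ((S t k ω * U)ᵀ * (S t k ω * U)).det) ∧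
    (∀ i j, Integrable (fun ω => regInv 0 (S t k ω * U) i j) P) ∧
    (∀ i j r s, Integrable
      (fun ω => regInv 0 (S t k ω * U) i j * regInv 0 (S t k ω * U) r s) P) ∧
    (∀ i j, ∫ ω, regInv 0 (S t k ω * U) i j ∂P = theta1 m d * (1 : Matrix _ _ ℝ) i j) ∧
    (∀ i j, ∫ ω, (regInv 0 (S t k ω * U) * regInv 0 (S t k ω * U)) i j ∂P
      = theta2 m d * (1 : Matrix _ _ ℝ) i j) := by
  have hm0 : (m : ℝ≥0) ≠ 0 := by
    have : 0 < m := by omega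
    positivity
  have hv : ((m : ℝ≥0)⁻¹) ≠ 0 := inv_ne_zero hm0
  have hm' : (d : ℝ) + 3 < m := by exact_mod_cast hm
  have hx : (3 : ℝ) < Fintype.card (Fin m) - Fintype.card (Fin d) := by
    simp only [Fintype.card_fin]
    linarith
  have hind : iIndepFun (fun (c : Fin m × Fin n) ω => S t k ω c.1 c.2) P :=
    hS.indep.precomp (g := fun c : Fin m × Fin n => (t, k, c.1, c.2)) fun c c' h => by
      simpa [Prod.ext_iff] using h
  obtain ⟨h1, -⟩ := ae_isUnit_det_gram_and_integrable_trace_sq hv (hS.measurable_entry t k)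
    (hS.law_entry t k) hind hU hx
  obtain ⟨h2, h3, h4, h5⟩ := inverse_gram_moments hv (hS.measurable_entry t k)
    (hS.law_entry t k) hind hU hx
  have hd : (0 : ℝ) ≤ d := by positivity
  have hmp : (m : ℝ) ≠ 0 := ne_of_gt (by linarith)
  have a1 : (m : ℝ) - d - 1 ≠ 0 := ne_of_gt (by linarith)
  have a2 : (m : ℝ) - d ≠ 0 := ne_of_gt (by linarith)
  have a3 : (m : ℝ) - d - 3 ≠ 0 := ne_of_gt (by linarith)
  refine ⟨h1, h2, h3, fun i j => ?_, fun i j => ?_⟩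
  · rw [h4, theta1, NNReal.coe_inv, NNReal.coe_natCast, Fintype.card_fin, Fintype.card_fin]
    congr 1
    field_simp
  · rw [h5, theta2, NNReal.coe_inv, NNReal.coe_natCast, Fintype.card_fin, Fintype.card_fin]
    congr 1
    field_simp

/-- The error decay for the recursion in orthonormal coordinates. -/
lemma IsIIDGaussianSketch.errCoord_decay (hS : IsIIDGaussianSketch P S) (hq : 0 < q)
    (hm : d + 3 < m) {U : Matrix (Fin n) (Fin d) ℝ} (hU : Uᵀ * U = 1) (v₀ : Fin d → ℝ)
    {y : ℕ → Ω → Fin d → ℝ} (hy : ∀ t ω, y t ω = errCoord (1 / theta1 m d * (1 / (q : ℝ)))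
      (fun t k => regInv 0 (S t k ω * U)) v₀ t) (t : ℕ) :
    Integrable (fun ω => y t ω ⬝ᵥ y t ω) P ∧
    P[fun ω => y (t + 1) ω ⬝ᵥ y (t + 1) ω | history S t] =ᵐ[P]
      fun ω => 1 / (q : ℝ) * (theta2 m d / theta1 m d ^ 2 - 1) * (y t ω ⬝ᵥ y t ω) := by
  set c := 1 / theta1 m d * (1 / (q : ℝ)) with hc
  set γ := 1 / (q : ℝ) * (theta2 m d / theta1 m d ^ 2 - 1) with hγ
  let W : ℕ → Fin q → Ω → Matrix (Fin d) (Fin d) ℝ := fun t k ω => regInv 0 (S t k ω * U)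
  let B : ℕ → Ω → Matrix (Fin d) (Fin d) ℝ := fun t ω =>
    (1 - c • ∑ k, W t k ω) * (1 - c • ∑ k, W t k ω)
  have hWm : ∀ {J : Set (ℕ × Fin q × Fin m × Fin n)} {t : ℕ} {k : Fin q},
      (∀ i j, (t, k, i, j) ∈ J) → ∀ i j, Measurable[entrySigma S J] fun ω => W t k ω i j :=
    fun {J t k} h i j => @measurable_regInv_apply _ _ _ _ _ _ _ (entrySigma S J) _ _
      (fun a b => measurable_entrySigma (h a b)) U 0 i j
  have hsucc : ∀ t ω, y (t + 1) ω = (1 - c • ∑ k, W t k ω) *ᵥ y t ω := fun t ω => by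
    rw [hy, hy, errCoord, Matrix.sub_mulVec, Matrix.one_mulVec, Matrix.smul_mulVec,
      Matrix.sum_mulVec]
  have hquad : ∀ t, (fun ω => y (t + 1) ω ⬝ᵥ y (t + 1) ω)
      = fun ω => y t ω ⬝ᵥ (B t ω *ᵥ y t ω) := fun t => by
    funext ω
    have hsymm : (1 - c • ∑ k, W t k ω)ᵀ = 1 - c • ∑ k, W t k ω := by
      simp [W, Matrix.transpose_sum, regInv_transpose]
    rw [hsucc, ← Matrix.mulVec_mulVec, Matrix.dotProduct_mulVec (y t ω), ← Matrix.mulVec_transpose,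
      hsymm]
  have hym : ∀ t i, Measurable[history S t] fun ω => y t ω i := by
    have key : ∀ s t, s ≤ t → ∀ i, Measurable[history S t] fun ω => y s ω i := by
      intro s
      induction s with
      | zero =>
        intro t _ i
        simp only [hy, errCoord]
        exact measurable_const
      | succ s ih =>
        intro t hst i
        have hW : ∀ k i j, Measurable[history S t] fun ω => W s k ω i j := fun k i j =>
          @measurable_regInv_apply _ _ _ _ _ _ _ (history S t) _ _
            (fun a b => measurable_history hst k a b) U 0 i j
        simp only [hsucc, Matrix.mulVec, dotProduct, Matrix.sub_apply, Matrix.smul_apply,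
          Matrix.sum_apply, smul_eq_mul]
        exact Finset.measurable_sum _ fun j _ => (measurable_const.sub
          ((Finset.measurable_sum _ fun k _ => hW k i j).const_mul c)).mul
          (ih t (Nat.le_of_succ_le hst) j)
    exact fun t => key t t le_rfl
  have hθ1 : theta1 m d ≠ 0 := by
    have hm' : (d : ℝ) + 3 < m := by exact_mod_cast hm
    have hd : (0 : ℝ) ≤ d := by positivity
    exact (div_pos (by linarith) (by linarith)).ne'
  have hq' : (q : ℝ) ≠ 0 := by positivity
  have hBmean : ∀ t i j, Integrable (fun ω => B t ω i j) P ∧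
      ∫ ω, B t ω i j ∂P = γ * (1 : Matrix _ _ ℝ) i j := fun t i j => by
    have hmom := fun k => hS.moments hm hU t k
    have hindW : ∀ k l, k ≠ l → ∀ i j r s,
        IndepFun (fun ω => W t k ω i j) (fun ω => W t l ω r s) P := fun k l hkl i j r s => by
      have hdisj : Disjoint {a : ℕ × Fin q × Fin m × Fin n | a.2.1 = k}
          {a : ℕ × Fin q × Fin m × Fin n | a.2.1 = l} :=
        Set.disjoint_left.2 fun a h1 h2 => hkl (h1.symm.trans h2)
      exact (IndepFun_iff_Indep _ _ _).2 (indep_of_indep_of_le (hS.indep_entrySigma hdisj)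
        (hWm (fun _ _ => rfl) i j).comap_le (hWm (fun _ _ => rfl) r s).comap_le)
    obtain ⟨h1, h2⟩ := integral_sq_one_sub_sum (W := W t) (fun k => (hmom k).2.1)
      (fun k => (hmom k).2.2.1) hindW (fun k => (hmom k).2.2.2.1) (fun k => (hmom k).2.2.2.2) c i j
    refine ⟨h1, h2.trans ?_⟩
    congr 1
    rw [hc, hγ]
    field_simp
    ring
  have hBm : ∀ t i j, Measurable[entrySigma S {a | a.1 = t}] fun ω => B t ω i j := fun t i j => by
    have hA : ∀ i j, Measurable[entrySigma S {a | a.1 = t}]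
        fun ω => (1 - c • ∑ k, W t k ω) i j := fun i j => by
      simp only [Matrix.sub_apply, Matrix.smul_apply, Matrix.sum_apply, smul_eq_mul]
      exact measurable_const.sub
        ((Finset.measurable_sum _ fun k _ => hWm (fun _ _ => rfl) i j).const_mul c)
    simp only [B, Matrix.mul_apply]
    exact Finset.measurable_sum _ fun r _ => (hA i r).mul (hA r j)
  have hindB : ∀ t, Indep (entrySigma S {a | a.1 = t}) (history S t) P := fun t => by
    have hdisj : Disjoint {a : ℕ × Fin q × Fin m × Fin n | a.1 = t}
        {a : ℕ × Fin q × Fin m × Fin n | a.1 < t} :=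
      Set.disjoint_left.2 fun a h1 h2 => (ne_of_lt h2) h1
    exact indep_of_indep_of_le_right (hS.indep_entrySigma hdisj) (history_le_entrySigma t)
  have hstep : ∀ t, Integrable (fun ω => y t ω ⬝ᵥ y t ω) P →
      Integrable (fun ω => y (t + 1) ω ⬝ᵥ y (t + 1) ω) P ∧
      P[fun ω => y (t + 1) ω ⬝ᵥ y (t + 1) ω | history S t] =ᵐ[P]
        fun ω => γ * (y t ω ⬝ᵥ y t ω) := fun t ht => by
    rw [hquad]
    exact condExp_quadraticForm (hS.history_le t) (hS.entrySigma_le _) (hindB t) (hym t) ht (hBm t)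
      (fun i j => (hBmean t i j).1) (fun i j => (hBmean t i j).2)
  have hint : ∀ t, Integrable (fun ω => y t ω ⬝ᵥ y t ω) P := fun t => by
    induction t with
    | zero =>
      simp only [hy, errCoord]
      exact integrable_const _
    | succ t ih => exact (hstep t ih).1
  exact ⟨hint t, (hstep t (hint t)).2⟩

end Sketches

end DistIHS

open DistIHS in
theorem mainTheorem6 {Ω : Type*} [MeasurableSpace Ω] (P : Measure Ω) [IsProbabilityMeasure P]
    (q m n d : ℕ) (hq : 0 < q) (hm : d + 3 < m)
    (A : Matrix (Fin n) (Fin d) ℝ) (hA : A.rank = d) (b : Fin n → ℝ)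
    (xstar : Fin d → ℝ)
    (hxstar : IsMinOn (fun x => DistIHS.sqNorm (A *ᵥ x - b)) Set.univ xstar)
    (x₀ : Fin d → ℝ)
    (S : ℕ → Fin q → Ω → Matrix (Fin m) (Fin n) ℝ)
    (hS : DistIHS.IsIIDGaussianSketch P S)
    (x : ℕ → Ω → Fin d → ℝ)
    (hx : ∀ t ω, x t ω =
      DistIHS.iterate A b (1 / DistIHS.theta1 m d) x₀ (fun s k => S s k ω) t) :
    ∀ t : ℕ,
      Integrable (fun ω => DistIHS.sqNorm (DistIHS.errorVec A xstar (x t ω))) P ∧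
      (P[fun ω => DistIHS.sqNorm (DistIHS.errorVec A xstar (x (t + 1) ω)) |
          DistIHS.history S t] =ᵐ[P]
        fun ω => 1 / (q : ℝ) * (DistIHS.theta2 m d / DistIHS.theta1 m d ^ 2 - 1) *
          DistIHS.sqNorm (DistIHS.errorVec A xstar (x t ω))) ∧
      ∫ ω, DistIHS.sqNorm (DistIHS.errorVec A xstar (x (t + 1) ω)) ∂P =
        1 / (q : ℝ) * (DistIHS.theta2 m d / DistIHS.theta1 m d ^ 2 - 1) *
          ∫ ω, DistIHS.sqNorm (DistIHS.errorVec A xstar (x t ω)) ∂P := by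
  intro t
  obtain ⟨U, T, hU, hT, rfl⟩ := exists_orthonormal_mul_isUnit (A := A) (by simpa using hA)
  have hnormal := transpose_mulVec_residual_eq_zero hxstar
  have hunit : ∀ᵐ ω ∂P, ∀ t k, IsUnit ((S t k ω * U)ᵀ * (S t k ω * U)).det :=
    ae_all_iff.2 fun t => ae_all_iff.2 fun k => (hS.moments hm hU t k).1
  let y : ℕ → Ω → Fin d → ℝ := fun t ω => errCoord (1 / theta1 m d * (1 / (q : ℝ)))
    (fun t k => regInv 0 (S t k ω * U)) (T *ᵥ (x₀ - xstar)) t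
  have hxy : ∀ t, (fun ω => sqNorm (errorVec (U * T) xstar (x t ω)))
      =ᵐ[P] fun ω => y t ω ⬝ᵥ y t ω := fun t => by
    filter_upwards [hunit] with ω hω
    rw [sqNorm_errorVec hU, hx, mulVec_iterate_sub hU hT hnormal _ _ hω]
  have hdecay := hS.errCoord_decay hq hm hU (T *ᵥ (x₀ - xstar)) (y := y) fun _ _ => rfl
  obtain ⟨h1, h2⟩ := hdecay t
  refine ⟨h1.congr (hxy t).symm, ?_, ?_⟩
  · refine (condExp_congr_ae (hxy (t + 1))).trans (h2.trans ?_)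
    filter_upwards [hxy t] with ω hω
    rw [hω]
  · rw [integral_congr_ae (hxy (t + 1)), integral_congr_ae (hxy t),
      ← integral_condExp (hS.history_le t), integral_congr_ae h2, integral_const_mul]
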